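/- Let $\mathcal{G}$ be a locally compact Hausdorff étale groupoid with compact unit space $\mathcal{G}^{(0)}$. A bisection is a subset $B\subseteq\mathcal{G}$ on which the source map $s$ and the range map $r$ are homeomorphisms onto their images; it defines a homeomorphism $\alpha_B\colon s(B)\to r(B)$, $\alpha_B(x)=r((s|_B)^{-1}(x))$. Let $M(\mathcal{G})$ be the convex set of probability Radon measures $\mu$ on $\mathcal{G}^{(0)}$ that are invariant, i.e. $\mu|_{r(B)}=(\alpha_B)_*(\mu|_{s(B)})$ for every open bisection $B$, with the weak$^*$-topology. Assume that $\mathcal{G}$ is essentially free: for every $\mu\in M(\mathcal{G})$ and every pre-compact open bisection $B\subseteq\mathcal{G}\setminus\mathcal{G}^{(0)}$ one has $\mu(\{x\in s(B):\alpha_B(x)=x\})=0$. Let $\|\cdot\|_\nu$ be a $C^*$-norm on the convolution $*$-algebra $C_c(\mathcal{G})$ that dominates the reduced $C^*$-norm, let $C^*_\nu(\mathcal{G})$ be the completion of $C_c(\mathcal{G})$ in this norm, and let $T(C^*_\nu(\mathcal{G}))$ be the convex set of its tracial states, with the weak$^*$-topology. For $\tau\in T(C^*_\nu(\mathcal{G}))$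 let $\mu_\tau$ be the unique probability Radon measure on $\mathcal{G}^{(0)}$ with $\tau(f)=\int_{\mathcal{G}^{(0)}}f\,d\mu_\tau$ for all $f\in C(\mathcal{G}^{(0)})\subseteq C^*_\nu(\mathcal{G})$. Then $\mu_\tau\in M(\mathcal{G})$, and the map $\tau\mapsto\mu_\tau$ is an affine homeomorphism from $T(C^*_\nu(\mathcal{G}))$ onto $M(\mathcal{G})$. Consequently it identifies the extreme boundaries: $\tau$ is an extreme point of $T(C^*_\nu(\mathcal{G}))$ if and only if $\mu_\tau$ is an extreme point of $M(\mathcal{G})$. In particular, the reduced norm and the maximal norm are $C^*$-norms on $C_c(\mathcal{G})$ for which all of this holds. -/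

import Mathlib

open scoped CompactlySupported ComplexOrder NNReal ENNReal Topology

universe u

/-- The algebraic structure of a groupoid on the set `G` of arrows, with the objects identified with
the identity arrows. The product `mul a b` is only meaningful (and only constrained) for composable
pairs, that is, when `src a = rng b`. -/
class GroupoidStructure (G : Type u) where
  src : G → G
  rng : G → G
  mul : G → G → G
  inv : G → G
  src_src : ∀ a, src (src a) = src a
  rng_src : ∀ a, rng (src a) = src a
  src_rng : ∀ a, src (rng a) = rng a
  rng_rng : ∀ a, rng (rng a) = rng a
  src_mul : ∀ a b, src a = rng b → src (mul a b) = src b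
  rng_mul : ∀ a b, src a = rng b → rng (mul a b) = rng a
  mul_assoc : ∀ a b c, src a = rng b → src b = rng c → mul (mul a b) c = mul a (mul b c)
  mul_src : ∀ a, mul a (src a) = a
  rng_mul_self : ∀ a, mul (rng a) a = a
  src_inv : ∀ a, src (inv a) = rng a
  rng_inv : ∀ a, rng (inv a) = src a
  mul_inv : ∀ a, mul a (inv a) = rng a
  inv_mul : ∀ a, mul (inv a) a = src a

namespace GroupoidStructure

section Algebra

variable {G : Type u} [GroupoidStructure G]

variable (G) in
/-- The set of units (identity arrows). -/
def units : Set G := {a | src a = a}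

variable (G) in
/-- The unit space, with the subspace topology and the restricted Borel structure. -/
abbrev UnitSpace : Type u := units G

/-- The source map onto the unit space. -/
def s (a : G) : UnitSpace G := ⟨src a, src_src a⟩

/-- The range map onto the unit space. -/
def r (a : G) : UnitSpace G := ⟨rng a, src_rng a⟩

/-- The set of arrows with source `x`. -/
abbrev SFiber (x : G) : Type u := {a : G // src a = x}

lemma rng_of_mem_units {a : G} (h : a ∈ units G) : rng a = a := by
  have h' : src a = a := h
  rw [← h', rng_src]

lemma mul_inv_cancel_right' {a b : G} (h : src a = rng b) : mul (mul a b) (inv b) = a := by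
  rw [mul_assoc _ _ _ h (rng_inv b).symm, mul_inv, ← h, mul_src]

lemma inv_mul_cancel_right' {a b : G} (h : src a = src b) : mul (mul a (inv b)) b = a := by
  rw [mul_assoc _ _ _ (by rw [rng_inv, h]) (src_inv b), inv_mul, ← h, mul_src]

lemma inv_inv' (a : G) : inv (inv a) = a := by
  have h := mul_inv (inv a)
  have h2 : mul (mul a (inv a)) (inv (inv a)) = mul a (mul (inv a) (inv (inv a))) :=
    mul_assoc _ _ _ (rng_inv a).symm (rng_inv (inv a)).symm
  rw [mul_inv, mul_inv, rng_inv, mul_src, ← src_inv a, ← rng_inv (inv a), rng_mul_self] at h2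
  exact h2

lemma inv_eq_of_mul_eq {a b : G} (h : src a = rng b) (h' : mul a b = rng a) : inv b = a := by
  have := mul_inv_cancel_right' h
  rw [h', ← src_inv a] at this
  have h3 : src b = rng a := by
    have := src_mul a b h
    rw [h', src_rng] at this
    exact this.symm
  have h4 := rng_mul_self (inv b)
  rw [rng_inv, h3, ← src_inv a] at h4
  rw [← h4, this]

lemma inv_mul' {a b : G} (h : src a = rng b) : inv (mul a b) = mul (inv b) (inv a) := by
  have hc : src (inv b) = rng (inv a) := by rw [src_inv, rng_inv, h]
  apply inv_eq_of_mul_eq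
  · rw [src_mul _ _ hc, src_inv, rng_mul _ _ h]
  · rw [mul_assoc _ _ _ hc (by rw [src_inv, rng_mul _ _ h]), rng_mul _ _ hc,
      ← mul_assoc _ _ _ (src_inv a) h, inv_mul, h, rng_mul_self, inv_mul, rng_inv]

lemma inv_of_mem_units {a : G} (h : a ∈ units G) : inv a = a := by
  have h1 : src a = a := h
  have h2 := rng_of_mem_units h
  have := mul_src (a := a)
  apply inv_eq_of_mul_eq
  · rw [h1, h2]
  · rw [h2]; nth_rewrite 2 [← h1]; exact mul_src a

/-- Right translation by `α`, from the arrows starting at the range of `α`. -/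
def rightMul (α : G) : SFiber (rng α) ≃ SFiber (src α) where
  toFun β := ⟨mul β α, src_mul _ _ β.2⟩
  invFun δ := ⟨mul δ (inv α), by rw [src_mul _ _ (by rw [δ.2, rng_inv]), src_inv]⟩
  left_inv β := Subtype.ext (mul_inv_cancel_right' β.2)
  right_inv δ := Subtype.ext (inv_mul_cancel_right' δ.2)

lemma inv_mul_inv {γ α : G} (h : src γ = src α) : inv (mul γ (inv α)) = mul α (inv γ) := by
  rw [inv_mul' (by rw [rng_inv, h]), inv_inv']

/-- The convolution product of functions on `G`. -/
noncomputable def conv (f g : G → ℂ) (γ : G) : ℂ :=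
  ∑ᶠ α : SFiber (src γ), f (mul γ (inv α)) * g α

/-- The involution on functions on `G`. -/
def involution (f : G → ℂ) (γ : G) : ℂ := star (f (inv γ))

/-- The arrow identity `(γ α⁻¹)(δ α⁻¹)⁻¹ = γ δ⁻¹`. -/
lemma mul_inv_mul_inv {γ α δ : G} (h : src γ = src α) (h' : src δ = src α) :
    mul (mul γ (inv α)) (inv (mul δ (inv α))) = mul γ (inv δ) := by
  have e1 : src γ = rng (inv α) := by rw [rng_inv, h]
  have e2 : src (inv α) = rng (mul α (inv δ)) := by
    rw [src_inv, rng_mul _ _ (by rw [rng_inv, h'])]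
  rw [inv_mul_inv h', mul_assoc _ _ _ e1 e2, ← mul_assoc _ _ _ (src_inv α) (by rw [rng_inv, h']),
    inv_mul, ← h', ← rng_inv δ, rng_mul_self]

lemma conv_eq (f g : G → ℂ) {γ x : G} (hx : src γ = x) :
    conv f g γ = ∑ᶠ α : SFiber x, f (mul γ (inv α)) * g α := by
  subst hx; rfl

lemma conv_translate (f g : G → ℂ) {γ α : G} (h : src γ = src α) :
    conv f g (mul γ (inv α)) =
      ∑ᶠ δ : SFiber (src γ), f (mul γ (inv δ)) * g (mul δ (inv α)) := by
  have hs : src (mul γ (inv α)) = rng α := by rw [src_mul _ _ (by rw [rng_inv, h]), src_inv]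
  rw [conv_eq f g hs, h]
  symm
  rw [← finsum_comp_equiv (rightMul α).symm]
  refine finsum_congr fun δ => ?_
  have e : (((rightMul α).symm δ : SFiber (rng α)) : G) = mul δ.1 (inv α) := rfl
  rw [e, mul_inv_mul_inv h δ.2]

/-- The integrand of the convolution, as a function on pairs of arrows with common source. -/
def convKernel (f g : G → ℂ) (q : {q : G × G // src q.1 = src q.2}) : ℂ :=
  f (mul q.1.1 (inv q.1.2)) * g q.1.2

lemma conv_eq_push (f g : G → ℂ) (γ : G) :
    conv f g γ = ∑ᶠ q ∈ (fun q : {q : G × G // src q.1 = src q.2} => q.1.1) ⁻¹' {γ},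
      convKernel f g q := by
  rw [← finsum_set_coe_eq_finsum_mem]
  refine finsum_eq_of_bijective (fun α => ⟨⟨(γ, α.1), α.2.symm⟩, rfl⟩) ⟨?_, ?_⟩ fun α => rfl
  · intro α β h
    have := congrArg (fun z => z.1.1.2) h
    exact Subtype.ext this
  · rintro ⟨⟨⟨a, b⟩, hab⟩, h⟩
    have h' : a = γ := h
    subst h'
    exact ⟨⟨b, hab.symm⟩, rfl⟩

lemma conv_smul_left (c : ℂ) (f g : G → ℂ) : conv (c • f) g = c • conv f g := by
  funext γ
  simp only [conv, Pi.smul_apply]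
  rw [smul_finsum]
  exact finsum_congr fun α => by simp [_root_.mul_assoc]

lemma conv_smul_right (c : ℂ) (f g : G → ℂ) : conv f (c • g) = c • conv f g := by
  funext γ
  simp only [conv, Pi.smul_apply]
  rw [smul_finsum]
  exact finsum_congr fun α => by simp [mul_left_comm]

lemma involution_involution (f : G → ℂ) : involution (involution f) = f := by
  funext γ
  simp [involution, inv_inv']

lemma involution_conv (f g : G → ℂ) :
    involution (conv f g) = conv (involution g) (involution f) := by
  funext γ
  simp only [involution]
  rw [conv_eq f g (src_inv γ), conv, ← finsum_comp_equiv (rightMul γ).symm]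
  have hm := AddMonoidHom.map_finsum_of_injective (starAddEquiv (R := ℂ)).toAddMonoidHom
    (starAddEquiv (R := ℂ)).injective (fun i : SFiber (src γ) =>
      f (mul (inv γ) (inv ((rightMul γ).symm i : SFiber (rng γ)))) *
        g ((rightMul γ).symm i : SFiber (rng γ)))
  refine hm.trans (finsum_congr fun δ => ?_)
  have e : (((rightMul γ).symm δ : SFiber (rng γ)) : G) = mul δ.1 (inv γ) := rfl
  have e1 : mul (inv γ) (inv (mul δ.1 (inv γ))) = inv δ.1 := by
    rw [← inv_mul' (by rw [src_mul _ _ (by rw [rng_inv, δ.2]), src_inv]),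
      inv_mul_cancel_right' δ.2]
  show star (_ * _) = _
  rw [star_mul, e, e1, involution, involution, inv_mul_inv δ.2.symm]

lemma conv_indicator_left (f g : G → ℂ) :
    conv ((units G).indicator f) g = fun γ => f (rng γ) * g γ := by
  funext γ
  rw [conv, finsum_eq_single _ (⟨γ, rfl⟩ : SFiber (src γ))]
  · rw [mul_inv, Set.indicator_of_mem (show rng γ ∈ units G from src_rng γ)]
  · intro α hα
    rw [Set.indicator_of_notMem, zero_mul]
    intro hu
    apply hα
    have h1 : src (mul γ (inv α)) = mul γ (inv α) := hu
    have h2 := rng_of_mem_units hu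
    have hc : src γ = rng (inv α.1) := by rw [rng_inv, α.2]
    rw [src_mul _ _ hc, src_inv] at h1
    rw [rng_mul _ _ hc] at h2
    have h3 := inv_mul_cancel_right' (a := γ) (b := α) α.2.symm
    rw [← h1, rng_mul_self] at h3
    exact Subtype.ext h3

lemma conv_indicator_right (f g : G → ℂ) :
    conv g ((units G).indicator f) = fun γ => g γ * f (src γ) := by
  funext γ
  rw [conv, finsum_eq_single _ (⟨src γ, src_src γ⟩ : SFiber (src γ))]
  · have hu : src γ ∈ units G := src_src γ
    show g (mul γ (inv (src γ))) * _ = _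
    rw [inv_of_mem_units hu, mul_src, Set.indicator_of_mem hu]
  · intro α hα
    rw [Set.indicator_of_notMem, mul_zero]
    intro hu
    exact hα (Subtype.ext ((show src α.1 = α.1 from hu).symm.trans α.2))

end Algebra

end GroupoidStructure

open GroupoidStructure

/-- An étale topological groupoid: the structure maps are continuous (the product on the subspace of
composable pairs), and the range map onto the unit space is a local homeomorphism. -/
class EtaleGroupoid (G : Type u) [TopologicalSpace G] [GroupoidStructure G] : Prop where
  continuous_src : Continuous (src : G → G)
  continuous_rng : Continuous (rng : G → G)
  continuous_inv : Continuous (inv : G → G)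
  continuous_mul : Continuous fun p : {p : G × G // src p.1 = rng p.2} => mul p.1.1 p.1.2
  isLocalHomeomorph_r : IsLocalHomeomorph (r : G → UnitSpace G)

/-! ### The completion of a normed `*`-algebra with the `C*`-identity -/

section CStarCompletion

variable {A : Type u} [NormedRing A] [StarRing A]

noncomputable instance instStarCompletion : Star (UniformSpace.Completion A) :=
  ⟨UniformSpace.Completion.map star⟩

lemma completion_continuous_star :
    Continuous (star : UniformSpace.Completion A → UniformSpace.Completion A) :=
  UniformSpace.Completion.continuous_map

variable [CStarRing A]

lemma uniformContinuous_star_of_cstar : UniformContinuous (star : A → A) :=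
  (star_isometry (E := A)).uniformContinuous

lemma completion_coe_star (a : A) :
    ((star a : A) : UniformSpace.Completion A) = star (a : UniformSpace.Completion A) :=
  (UniformSpace.Completion.map_coe uniformContinuous_star_of_cstar a).symm

/-- The completion of a normed `*`-algebra satisfying the `C*`-identity is a `C*`-algebra. -/
noncomputable instance instCStarAlgebraCompletion [NormedAlgebra ℂ A] [StarModule ℂ A] :
    CStarAlgebra (UniformSpace.Completion A) where
  star_involutive a := by
    refine UniformSpace.Completion.induction_on a ?_ fun a => ?_
    · exact isClosed_eq (completion_continuous_star.comp completion_continuous_star) continuous_id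
    · rw [← completion_coe_star, ← completion_coe_star, star_star]
  star_mul a b := by
    refine UniformSpace.Completion.induction_on₂ a b ?_ fun a b => ?_
    · exact isClosed_eq (completion_continuous_star.comp continuous_mul)
        ((completion_continuous_star.comp continuous_snd).mul
          (completion_continuous_star.comp continuous_fst))
    · rw [← UniformSpace.Completion.coe_mul, ← completion_coe_star, star_mul,
        UniformSpace.Completion.coe_mul, completion_coe_star, completion_coe_star]
  star_add a b := by
    refine UniformSpace.Completion.induction_on₂ a b ?_ fun a b => ?_
    · exact isClosed_eq (completion_continuous_star.comp continuous_add)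
        ((completion_continuous_star.comp continuous_fst).add
          (completion_continuous_star.comp continuous_snd))
    · rw [← UniformSpace.Completion.coe_add, ← completion_coe_star, star_add,
        UniformSpace.Completion.coe_add, completion_coe_star, completion_coe_star]
  norm_mul_self_le a := by
    refine UniformSpace.Completion.induction_on a ?_ fun a => ?_
    · exact isClosed_le (continuous_norm.mul continuous_norm)
        ((completion_continuous_star.mul continuous_id).norm)
    · rw [← completion_coe_star, ← UniformSpace.Completion.coe_mul,
        UniformSpace.Completion.norm_coe, UniformSpace.Completion.norm_coe]
      exact CStarRing.norm_mul_self_le a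
  norm_smul_le c a := norm_smul_le c a
  star_smul c a := by
    refine UniformSpace.Completion.induction_on a ?_ fun a => ?_
    · exact isClosed_eq (completion_continuous_star.comp (continuous_const_smul c))
        ((completion_continuous_star).const_smul (star c))
    · rw [← UniformSpace.Completion.coe_smul, ← completion_coe_star, star_smul,
        UniformSpace.Completion.coe_smul, completion_coe_star]

end CStarCompletion

/-- The set of tracial states of a unital `C*`-algebra, with the weak-`*` topology on the
surrounding dual space: positive unital functionals `τ` with `τ (a b) = τ (b a)`. -/
def tracialStates (A : Type*) [CStarAlgebra A] : Set (WeakDual ℂ A) :=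
  {τ | (∀ a, 0 ≤ τ (star a * a)) ∧ τ 1 = 1 ∧ ∀ a b, τ (a * b) = τ (b * a)}

namespace GroupoidStructure

/-! ### Summation over the fibres of a local homeomorphism -/

section Push

variable {E B : Type*} [TopologicalSpace E] [TopologicalSpace B] [T2Space B]
  {p : E → B} {h : E → ℂ}

lemma finite_fiber_inter (hp : IsLocalHomeomorph p) {K : Set E} (hK : IsCompact K) (b : B) :
    (p ⁻¹' {b} ∩ K).Finite := by
  have hc : IsCompact (p ⁻¹' {b} ∩ K) :=
    hK.inter_left ((isClosed_singleton).preimage hp.continuous)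
  choose U hU using fun e => hp e
  obtain ⟨t, -, ht⟩ := hc.elim_nhds_subcover (fun e => (U e).source)
    (fun e _ => (U e).open_source.mem_nhds (hU e).1)
  refine (Set.Finite.biUnion t.finite_toSet (t := fun e => p ⁻¹' {b} ∩ (U e).source) ?_).subset ?_
  · intro e _
    apply Set.Subsingleton.finite
    rintro x ⟨hx, hx'⟩ y ⟨hy, hy'⟩
    apply (U e).injOn hx' hy'
    rw [← (hU e).2]; exact hx.trans hy.symm
  · intro x hx
    have := ht hx
    simp only [Set.mem_iUnion] at this ⊢
    obtain ⟨e, he, h'⟩ := this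
    exact ⟨e, he, hx.1, h'⟩

lemma continuous_push [T2Space E] (hp : IsLocalHomeomorph p) (hc : Continuous h)
    (hs : HasCompactSupport h) : Continuous fun b => ∑ᶠ e ∈ p ⁻¹' {b}, h e := by
  classical
  rw [continuous_iff_continuousAt]
  intro b
  have hfin := finite_fiber_inter hp hs b
  obtain ⟨V, hV, hVd⟩ := hfin.t2_separation
  choose U hU using fun e => hp e
  let φ : E → OpenPartialHomeomorph E B := fun e => (U e).restrOpen (V e) (hV e).2
  have hφs : ∀ e, (φ e).source = (U e).source ∩ V e := fun e => (U e).restrOpen_source _ _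
  have hφ : ∀ e x, φ e x = p x := fun e x => by rw [(hU e).2]; rfl
  have hes : ∀ e, e ∈ (φ e).source := fun e => by rw [hφs]; exact ⟨(hU e).1, (hV e).1⟩
  set F := hfin.toFinset with hF
  have hFp : ∀ e ∈ F, p e = b := fun e he => ((hfin.mem_toFinset).1 he).1
  have hbt : ∀ e ∈ F, b ∈ (φ e).target := fun e he => by
    rw [← hFp e he, ← hφ e]; exact (φ e).map_source (hes e)
  let K' : Set E := tsupport h \ ⋃ e ∈ F, (φ e).source
  have hK' : IsCompact K' := hs.diff (isOpen_biUnion fun e _ => (φ e).open_source)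
  have hbK : b ∉ p '' K' := by
    rintro ⟨e, he, rfl⟩
    apply he.2
    simp only [Set.mem_iUnion]
    exact ⟨e, (hfin.mem_toFinset).2 ⟨rfl, he.1⟩, hes e⟩
  have ev1 : ∀ᶠ x in 𝓝 b, x ∉ p '' K' :=
    (hK'.image hp.continuous).isClosed.isOpen_compl.mem_nhds hbK
  have ev2 : ∀ᶠ x in 𝓝 b, ∀ e ∈ F, x ∈ (φ e).target :=
    (Filter.eventually_all_finset F).2 fun e he => (φ e).open_target.mem_nhds (hbt e he)
  have key : ∀ᶠ x in 𝓝 b, ∑ e ∈ F, h ((φ e).symm x) = ∑ᶠ e ∈ p ⁻¹' {x}, h e := by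
    filter_upwards [ev1, ev2] with x hx1 hx2
    have hinj : Set.InjOn (fun e => (φ e).symm x) F := by
      intro e he e' he' hee
      by_contra hne
      have h1 := (φ e).map_target (hx2 e he)
      have h2 := (φ e').map_target (hx2 e' he')
      simp only at hee
      rw [← hee] at h2
      rw [hφs] at h1 h2
      exact Set.disjoint_left.1 (hVd ((hfin.mem_toFinset).1 he) ((hfin.mem_toFinset).1 he') hne)
        h1.2 h2.2
    rw [← Finset.sum_image (f := h) hinj]
    symm
    apply finsum_mem_eq_sum_of_inter_support_eq
    ext y
    simp only [Set.mem_inter_iff, Set.mem_preimage, Set.mem_singleton_iff, Finset.coe_image,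
      Set.mem_image, Finset.mem_coe]
    refine and_congr_left fun hy => ⟨fun hyx => ?_, ?_⟩
    · by_cases hyK : y ∈ K'
      · exact absurd ⟨y, hyK, hyx⟩ hx1
      · have : y ∈ ⋃ e ∈ F, (φ e).source := by
          by_contra hcon
          exact hyK ⟨subset_tsupport h hy, hcon⟩
        simp only [Set.mem_iUnion] at this
        obtain ⟨e, he, hye⟩ := this
        refine ⟨e, he, ?_⟩
        rw [← hyx, ← hφ e]; exact (φ e).left_inv hye
    · rintro ⟨e, he, rfl⟩
      rw [← hφ e]; exact (φ e).right_inv (hx2 e he)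
  refine ContinuousAt.congr ?_ key
  refine tendsto_finsetSum _ fun e he => ?_
  exact (hc.continuousAt).comp ((φ e).continuousAt_symm (hbt e he))

lemma hasCompactSupport_push (hp : IsLocalHomeomorph p)
    (hs : HasCompactSupport h) : HasCompactSupport fun b => ∑ᶠ e ∈ p ⁻¹' {b}, h e := by
  refine HasCompactSupport.intro (hs.image hp.continuous) fun x hx => ?_
  apply finsum_mem_eq_zero_of_forall_eq_zero
  intro e he
  by_contra hne
  exact hx ⟨e, subset_tsupport h hne, he⟩

end Push

/-! ### The convolution algebra of continuous compactly supported functions -/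

section Top

variable {G : Type u} [TopologicalSpace G] [GroupoidStructure G] [EtaleGroupoid G]

lemma continuous_s : Continuous (s : G → UnitSpace G) :=
  EtaleGroupoid.continuous_src.subtype_mk _

lemma continuous_r : Continuous (r : G → UnitSpace G) :=
  EtaleGroupoid.continuous_rng.subtype_mk _

variable (G) in
/-- Inversion as a homeomorphism. -/
def invHomeo : G ≃ₜ G where
  toFun := inv
  invFun := inv
  left_inv := inv_inv'
  right_inv := inv_inv'
  continuous_toFun := EtaleGroupoid.continuous_inv
  continuous_invFun := EtaleGroupoid.continuous_inv

lemma isLocalHomeomorph_s : IsLocalHomeomorph (s : G → UnitSpace G) := by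
  have : (s : G → UnitSpace G) = r ∘ invHomeo G := by
    funext a; exact Subtype.ext (rng_inv a).symm
  rw [this]
  exact EtaleGroupoid.isLocalHomeomorph_r.comp (invHomeo G).isLocalHomeomorph

lemma isOpen_units : IsOpen (units G) := by
  rw [isOpen_iff_mem_nhds]
  intro x hx
  obtain ⟨e, hxe, he⟩ := EtaleGroupoid.isLocalHomeomorph_r x
  have hr : rng x = x := rng_of_mem_units hx
  have h1 : e.source ∈ 𝓝 x := e.open_source.mem_nhds hxe
  have h2 : rng ⁻¹' e.source ∈ 𝓝 x :=
    (e.open_source.preimage EtaleGroupoid.continuous_rng).mem_nhds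
      (show rng x ∈ e.source by rw [hr]; exact hxe)
  filter_upwards [h1, h2] with y hy1 hy2
  have : rng y = y := by
    apply e.injOn hy2 hy1
    rw [← he]; exact Subtype.ext (rng_rng y)
  show src y = y
  rw [← this, src_rng]

/-- The pull-back of the source map along itself. -/
lemma isLocalHomeomorph_fst :
    IsLocalHomeomorph fun q : {q : G × G // src q.1 = src q.2} => q.1.1 := by
  have hcont : Continuous fun q : {q : G × G // src q.1 = src q.2} => q.1.1 :=
    continuous_fst.comp continuous_subtype_val
  have hopen : IsOpenMap fun q : {q : G × G // src q.1 = src q.2} => q.1.1 := by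
    refine IsOpenMap.of_nhds_le fun q => ?_
    obtain ⟨⟨γ, α⟩, hq⟩ := q
    intro W hW
    rw [Filter.mem_map, nhds_subtype_eq_comap, Filter.mem_comap] at hW
    obtain ⟨W', hW', hsub⟩ := hW
    obtain ⟨e, hαe, he⟩ := isLocalHomeomorph_s α
    have hsα : s γ = e α := by rw [← he]; exact Subtype.ext hq
    have hmem : s γ ∈ e.target := by rw [hsα]; exact e.map_source hαe
    have hσ : ContinuousAt (fun γ' : G => (γ', e.symm (s γ'))) γ :=
      continuousAt_id.prodMk ((e.continuousAt_symm hmem).comp continuous_s.continuousAt)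
    have hσv : (γ, e.symm (s γ)) = (γ, α) := by rw [hsα, e.left_inv hαe]
    have h1 : ∀ᶠ γ' in 𝓝 γ, (γ', e.symm (s γ')) ∈ W' := by
      apply hσ
      simp only [hσv]
      exact hW'
    have h2 : ∀ᶠ γ' in 𝓝 γ, s γ' ∈ e.target :=
      continuous_s.continuousAt (e.open_target.mem_nhds hmem)
    filter_upwards [h1, h2] with γ' h1 h2
    have hc : src γ' = src (e.symm (s γ')) := by
      have := e.right_inv h2
      rw [← he] at this
      exact (congrArg Subtype.val this).symm
    exact hsub (a := ⟨(γ', e.symm (s γ')), hc⟩) h1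
  rw [isLocalHomeomorph_iff_isOpenEmbedding_restrict]
  intro q
  obtain ⟨e, hαe, he⟩ := isLocalHomeomorph_s q.1.2
  have hUo : IsOpen {z : {q : G × G // src q.1 = src q.2} | z.1.2 ∈ e.source} :=
    e.open_source.preimage (continuous_snd.comp continuous_subtype_val)
  refine ⟨{z | z.1.2 ∈ e.source}, hUo.mem_nhds hαe, ?_⟩
  refine .of_continuous_injective_isOpenMap (hcont.comp continuous_subtype_val) ?_
    (hopen.domRestrict hUo)
  rintro ⟨⟨⟨a, b⟩, hab⟩, hb⟩ ⟨⟨⟨a', b'⟩, hab'⟩, hb'⟩ heq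
  have h1 : a = a' := heq
  subst h1
  have h2 : b = b' := by
    apply e.injOn hb hb'
    rw [← he]
    exact Subtype.ext (hab.symm.trans hab')
  subst h2
  rfl

lemma continuous_convKernel {f g : G → ℂ} (hf : Continuous f) (hg : Continuous g) :
    Continuous (convKernel f g) := by
  have h1 : Continuous fun q : {q : G × G // src q.1 = src q.2} => mul q.1.1 (inv q.1.2) := by
    have h2 : Continuous fun q : {q : G × G // src q.1 = src q.2} =>
        (⟨(q.1.1, inv q.1.2), by rw [rng_inv]; exact q.2⟩ : {p : G × G // src p.1 = rng p.2}) :=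
      (((continuous_fst.comp continuous_subtype_val).prodMk
        (EtaleGroupoid.continuous_inv.comp
          (continuous_snd.comp continuous_subtype_val)))).subtype_mk _
    exact EtaleGroupoid.continuous_mul.comp h2
  exact (hf.comp h1).mul (hg.comp (continuous_snd.comp continuous_subtype_val))

variable [T2Space G]

lemma isClosed_units : IsClosed (units G) :=
  isClosed_eq EtaleGroupoid.continuous_src continuous_id

lemma isClopen_units : IsClopen (units G) := ⟨isClosed_units, isOpen_units⟩

lemma finite_fiber (x : G) {f : G → ℂ} (hf : HasCompactSupport f) :
    (Function.support fun α : SFiber x => f α).Finite := by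
  by_cases hx : x ∈ units G
  · have := (finite_fiber_inter (isLocalHomeomorph_s (G := G)) hf ⟨x, hx⟩)
    refine Set.Finite.of_finite_image (f := Subtype.val) (this.subset ?_)
      Subtype.val_injective.injOn
    rintro _ ⟨α, hα, rfl⟩
    exact ⟨Subtype.ext α.2, subset_tsupport f hα⟩
  · have : IsEmpty (SFiber x) := ⟨fun α => hx (by
      show src x = x
      rw [← α.2, src_src])⟩
    exact Set.toFinite _


section Conv

variable {f g : G → ℂ}

lemma hasCompactSupport_convKernel (hf : HasCompactSupport f) (hg : HasCompactSupport g) :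
    HasCompactSupport (convKernel f g) := by
  have hcl : Topology.IsClosedEmbedding
      (Subtype.val : {p : G × G // src p.1 = rng p.2} → G × G) :=
    (isClosed_eq (EtaleGroupoid.continuous_src.comp continuous_fst)
      (EtaleGroupoid.continuous_rng.comp continuous_snd)).isClosedEmbedding_subtypeVal
  have hK := hcl.isCompact_preimage (hf.prod hg)
  have hΨ : Continuous fun p : {p : G × G // src p.1 = rng p.2} =>
      (⟨(mul p.1.1 p.1.2, p.1.2), src_mul _ _ p.2⟩ : {q : G × G // src q.1 = src q.2}) :=
    (EtaleGroupoid.continuous_mul.prodMk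
      (continuous_snd.comp continuous_subtype_val)).subtype_mk _
  refine HasCompactSupport.intro (hK.image hΨ) fun q hq => ?_
  by_contra hne
  apply hq
  refine ⟨⟨(mul q.1.1 (inv q.1.2), q.1.2), ?_⟩, ⟨?_, ?_⟩, ?_⟩
  · rw [src_mul _ _ (by rw [rng_inv]; exact q.2), src_inv]
  · exact subset_tsupport f (left_ne_zero_of_mul hne)
  · exact subset_tsupport g (right_ne_zero_of_mul hne)
  · exact Subtype.ext (Prod.ext (inv_mul_cancel_right' q.2) rfl)

lemma continuous_conv (hf : Continuous f) (hg : Continuous g) (hf' : HasCompactSupport f)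
    (hg' : HasCompactSupport g) : Continuous (conv f g) := by
  have : conv f g = _ := funext (conv_eq_push f g)
  rw [this]
  exact continuous_push isLocalHomeomorph_fst (continuous_convKernel hf hg)
    (hasCompactSupport_convKernel hf' hg')

lemma hasCompactSupport_conv (hf' : HasCompactSupport f)
    (hg' : HasCompactSupport g) : HasCompactSupport (conv f g) := by
  have : conv f g = _ := funext (conv_eq_push f g)
  rw [this]
  exact hasCompactSupport_push isLocalHomeomorph_fst (hasCompactSupport_convKernel hf' hg')

lemma finite_fiber_left (γ : G) (hf : HasCompactSupport f) :
    (Function.support fun α : SFiber (src γ) => f (mul γ (inv α))).Finite := by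
  have hfin := finite_fiber (rng γ) (hf.comp_homeomorph (invHomeo G))
  refine (hfin.preimage (rightMul γ).symm.injective.injOn).subset fun α hα => ?_
  have e : inv (((rightMul γ).symm α : SFiber (rng γ)) : G) = mul γ (inv α) :=
    inv_mul_inv (γ := α.1) (α := γ) α.2
  show f (inv (((rightMul γ).symm α : SFiber (rng γ)) : G)) ≠ 0
  rw [e]
  exact hα

lemma conv_assoc {h : G → ℂ} (hf : HasCompactSupport f) (hh : HasCompactSupport h) :
    conv (conv f g) h = conv f (conv g h) := by
  funext γ
  have hS := finite_fiber_left γ hf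
  have hT := finite_fiber (src γ) hh
  have e1 : conv (conv f g) h γ =
      ∑ α ∈ hT.toFinset, (∑ δ ∈ hS.toFinset, f (mul γ (inv δ)) * g (mul δ (inv α))) * h α := by
    rw [conv, finsum_eq_sum_of_support_subset (s := hT.toFinset)]
    · refine Finset.sum_congr rfl fun α _ => ?_
      rw [conv_translate f g α.2.symm, finsum_eq_sum_of_support_subset (s := hS.toFinset)]
      intro δ hδ
      simpa using left_ne_zero_of_mul hδ
    · intro α hα
      simpa using right_ne_zero_of_mul hα
  have e2 : conv f (conv g h) γ =
      ∑ δ ∈ hS.toFinset, f (mul γ (inv δ)) * ∑ α ∈ hT.toFinset, g (mul δ (inv α)) * h α := by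
    rw [conv, finsum_eq_sum_of_support_subset (s := hS.toFinset)]
    · refine Finset.sum_congr rfl fun δ _ => ?_
      rw [conv_eq g h δ.2, finsum_eq_sum_of_support_subset (s := hT.toFinset)]
      intro α hα
      simpa using right_ne_zero_of_mul hα
    · intro δ hδ
      simpa using left_ne_zero_of_mul hδ
  rw [e1, e2]
  simp_rw [Finset.sum_mul, Finset.mul_sum, _root_.mul_assoc]
  exact Finset.sum_comm

lemma conv_add_left (f' : G → ℂ) (hg : HasCompactSupport g) :
    conv (f + f') g = conv f g + conv f' g := by
  funext γ
  have hT := finite_fiber (src γ) hg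
  simp only [conv, Pi.add_apply]
  rw [← finsum_add_distrib]
  · exact finsum_congr fun α => by ring
  · exact hT.subset fun α hα => right_ne_zero_of_mul hα
  · exact hT.subset fun α hα => right_ne_zero_of_mul hα

lemma conv_add_right {g' : G → ℂ} (hg : HasCompactSupport g) (hg' : HasCompactSupport g') :
    conv f (g + g') = conv f g + conv f g' := by
  funext γ
  simp only [conv, Pi.add_apply]
  rw [← finsum_add_distrib]
  · exact finsum_congr fun α => by ring
  · exact (finite_fiber (src γ) hg).subset fun α hα => right_ne_zero_of_mul hα
  · exact (finite_fiber (src γ) hg').subset fun α hα => right_ne_zero_of_mul hα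

end Conv

end Top

section Cc

/-- The complex vector space of continuous compactly supported functions on `G`, to be
equipped with the convolution product (and not with the pointwise one). -/
def Cc (G : Type u) [TopologicalSpace G] : Type u := C_c(G, ℂ)

variable {G : Type u} [TopologicalSpace G]

namespace Cc

instance : FunLike (Cc G) G ℂ := inferInstanceAs (FunLike C_c(G, ℂ) G ℂ)

noncomputable instance : AddCommGroup (Cc G) := inferInstanceAs (AddCommGroup C_c(G, ℂ))

noncomputable instance : Module ℂ (Cc G) := inferInstanceAs (Module ℂ C_c(G, ℂ))

lemma continuous (f : Cc G) : Continuous f := ContinuousMap.continuous (CompactlySupportedContinuousMap.toContinuousMap f)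

lemma hasCompactSupport (f : Cc G) : HasCompactSupport f :=
  CompactlySupportedContinuousMap.hasCompactSupport' f

/-- Constructor from a function. -/
def of (f : G → ℂ) (h : Continuous f) (h' : HasCompactSupport f) : Cc G :=
  (⟨⟨f, h⟩, h'⟩ : C_c(G, ℂ))

@[simp] lemma coe_of (f : G → ℂ) (h : Continuous f) (h' : HasCompactSupport f) :
    ⇑(of f h h') = f := rfl

lemma coe_inj {f g : Cc G} (h : (f : G → ℂ) = g) : f = g := DFunLike.coe_injective h

@[simp] lemma coe_add (f g : Cc G) : ⇑(f + g) = f + g := rfl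
@[simp] lemma coe_zero : ⇑(0 : Cc G) = 0 := rfl
@[simp] lemma coe_smul (c : ℂ) (f : Cc G) : ⇑(c • f) = c • ⇑f := rfl

variable [GroupoidStructure G] [EtaleGroupoid G]

/-- The involution `f* (γ) = conj (f (γ⁻¹))`. -/
noncomputable instance : Star (Cc G) where
  star f := of (involution f) (f.continuous.comp EtaleGroupoid.continuous_inv).star
    ((f.hasCompactSupport.comp_homeomorph (invHomeo G)).comp_left (star_zero ℂ))

@[simp] lemma coe_star (f : Cc G) : ⇑(star f) = involution f := rfl

variable [T2Space G]

/-- The convolution product. -/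
noncomputable instance : Mul (Cc G) where
  mul f g := of (conv f g)
    (continuous_conv f.continuous g.continuous f.hasCompactSupport g.hasCompactSupport)
    (hasCompactSupport_conv f.hasCompactSupport g.hasCompactSupport)

@[simp] lemma coe_mul (f g : Cc G) : ⇑(f * g) = conv f g := rfl

noncomputable instance : NonUnitalRing (Cc G) where
  mul_assoc f g h := coe_inj (conv_assoc f.hasCompactSupport h.hasCompactSupport)
  left_distrib f _ _ := coe_inj (conv_add_right (f := f) (hasCompactSupport _)
    (hasCompactSupport _))
  right_distrib _ _ h := coe_inj (conv_add_left _ h.hasCompactSupport)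
  zero_mul _ := coe_inj (funext fun γ => by simp [conv])
  mul_zero _ := coe_inj (funext fun γ => by simp [conv])

noncomputable instance : StarRing (Cc G) where
  star_involutive f := coe_inj (involution_involution f)
  star_mul f g := coe_inj (involution_conv f g)
  star_add f g := coe_inj (funext fun γ => by simp [involution])

instance : IsScalarTower ℂ (Cc G) (Cc G) :=
  ⟨fun c f g => coe_inj (conv_smul_left c f g)⟩

instance : SMulCommClass ℂ (Cc G) (Cc G) :=
  ⟨fun c f g => coe_inj (conv_smul_right c f g).symm⟩

instance : StarModule ℂ (Cc G) :=
  ⟨fun c f => coe_inj (funext fun γ => by simp [involution])⟩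

section Unital

variable [CompactSpace (UnitSpace G)]

/-- The inclusion of the functions on the (compact) unit space into `C_c(G)`: the function `f`
is extended by zero outside of the units. -/
noncomputable def inclusion (f : C(UnitSpace G, ℂ)) : Cc G :=
  of ((units G).indicator fun γ => f (s γ))
    ((f.continuous.comp continuous_s).indicator (by simp [isClopen_units.frontier_eq]))
    (HasCompactSupport.intro (isCompact_iff_compactSpace.2 inferInstance : IsCompact (units G))
      fun _ h => Set.indicator_of_notMem h _)

noncomputable instance : One (Cc G) := ⟨inclusion 1⟩

lemma coe_one : ⇑(1 : Cc G) = (units G).indicator fun _ => 1 := rfl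

noncomputable instance : Ring (Cc G) where
  __ := (inferInstance : NonUnitalRing (Cc G))
  one_mul f := coe_inj (by rw [coe_mul, coe_one, conv_indicator_left]; simp)
  mul_one f := coe_inj (by rw [coe_mul, coe_one, conv_indicator_right]; simp)

noncomputable instance : Algebra ℂ (Cc G) :=
  Algebra.ofModule (fun c f g => smul_mul_assoc c f g) (fun c f g => mul_smul_comm c f g)

end Unital

end Cc

/-! ### The reduced and the maximal norm -/

section Norms

variable [GroupoidStructure G] [EtaleGroupoid G]

/-- The sum of `|f|` over the arrows with source `x`. -/
noncomputable def fiberSum (f : Cc G) (x : UnitSpace G) : ℝ := ∑ᶠ γ : SFiber (x : G), ‖f γ‖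

/-- The `I`-norm on `C_c(G)`. -/
noncomputable def iNorm (f : Cc G) : ℝ :=
  max (⨆ x : UnitSpace G, fiberSum f x) (⨆ x : UnitSpace G, fiberSum (star f) x)

lemma iNorm_nonneg (f : Cc G) : 0 ≤ iNorm f := by
  refine le_max_of_le_left (Real.iSup_nonneg fun x => ?_)
  exact finsum_nonneg fun _ => norm_nonneg _

variable [T2Space G]

lemma bddAbove_fiberSum (f : Cc G) : BddAbove (Set.range (fiberSum f)) := by
  let h : G → ℂ := fun γ => (‖f γ‖ : ℂ)
  have hc : Continuous h := Complex.continuous_ofReal.comp f.continuous.norm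
  have hs : HasCompactSupport h := f.hasCompactSupport.comp_left (g := fun z : ℂ => (‖z‖ : ℂ))
    (by simp)
  obtain ⟨C, hC⟩ := (continuous_push isLocalHomeomorph_s hc hs).bounded_above_of_compact_support
    (hasCompactSupport_push isLocalHomeomorph_s hs)
  refine ⟨C, ?_⟩
  rintro _ ⟨x, rfl⟩
  have hx : (∑ᶠ e ∈ (s : G → UnitSpace G) ⁻¹' {x}, h e) = (fiberSum f x : ℂ) := by
    rw [← finsum_set_coe_eq_finsum_mem]
    have h1 := AddMonoidHom.map_finsum_of_injective (Complex.ofRealHom : ℝ →+* ℂ).toAddMonoidHom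
      Complex.ofReal_injective (fun γ : SFiber (x : G) => ‖f γ‖)
    refine Eq.trans ?_ h1.symm
    refine finsum_eq_of_bijective (fun e => ⟨e.1, congrArg Subtype.val e.2⟩) ⟨?_, ?_⟩ fun e => rfl
    · intro a b hab
      exact Subtype.ext (congrArg (fun z => z.1) hab)
    · intro a
      exact ⟨⟨a.1, Subtype.ext a.2⟩, rfl⟩
  have := hC x
  rw [hx] at this
  exact (le_abs_self _).trans (by simpa using this)

lemma fiberSum_le (f : Cc G) (x : UnitSpace G) : fiberSum f x ≤ iNorm f :=
  (le_ciSup (bddAbove_fiberSum f) x).trans (le_max_left _ _)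

lemma fiberSum_star_le (f : Cc G) (x : UnitSpace G) : fiberSum (star f) x ≤ iNorm f :=
  (le_ciSup (bddAbove_fiberSum (star f)) x).trans (le_max_right _ _)

lemma sum_le_fiberSum (f : Cc G) (x : UnitSpace G) {ι : Type*} (T : Finset ι)
    (φ : ι → SFiber (x : G)) (hφ : Function.Injective φ) :
    ∑ i ∈ T, ‖f (φ i)‖ ≤ fiberSum f x := by
  have hfin : (Function.support fun γ : SFiber (x : G) => ‖f γ‖).Finite :=
    (finite_fiber (x : G) f.hasCompactSupport).subset fun γ h => by simpa using h
  rw [fiberSum, ← tsum_eq_finsum (L := .unconditional _) hfin]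
  have hsum : Summable fun γ : SFiber (x : G) => ‖f γ‖ := summable_of_hasFiniteSupport hfin
  have := hsum.sum_le_tsum (T.map ⟨φ, hφ⟩) (fun _ _ => norm_nonneg _)
  rwa [Finset.sum_map] at this

lemma column_le (f : Cc G) {x : G} (S : Finset (SFiber x)) (α : SFiber x) :
    ∑ γ ∈ S, ‖f (mul γ.1 (inv α.1))‖ ≤ iNorm f := by
  obtain ⟨α, rfl⟩ := α
  exact (sum_le_fiberSum f (r α) S (rightMul α).symm (rightMul α).symm.injective).trans
    (fiberSum_le f _)

lemma row_le (f : Cc G) {x : G} (T : Finset (SFiber x)) (γ : SFiber x) :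
    ∑ α ∈ T, ‖f (mul γ.1 (inv α.1))‖ ≤ iNorm f := by
  obtain ⟨γ, rfl⟩ := γ
  refine le_trans (le_of_eq (Finset.sum_congr rfl fun α _ => ?_))
    ((sum_le_fiberSum (star f) (r γ) T (rightMul γ).symm (rightMul γ).symm.injective).trans
      (fiberSum_star_le f _))
  have e : (((rightMul γ).symm α : SFiber (rng γ)) : G) = mul α.1 (inv γ) := rfl
  rw [e, Cc.coe_star, involution, norm_star, inv_mul_inv α.2]

/-- The formula for the left regular representation: `(λ_x(f) ξ)(γ) = ∑ f(γ α⁻¹) ξ(α)`. -/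
noncomputable def regFun (f : Cc G) {x : G} (ξ : SFiber x → ℂ) (γ : SFiber x) : ℂ :=
  ∑ᶠ α : SFiber x, f (mul γ.1 (inv α.1)) * ξ α

lemma finite_row (f : Cc G) {x : G} (γ : SFiber x) :
    (Function.support fun α : SFiber x => f (mul γ.1 (inv α.1))).Finite := by
  obtain ⟨γ, rfl⟩ := γ
  exact finite_fiber_left γ f.hasCompactSupport

lemma regFun_eq_sum (f : Cc G) {x : G} (ξ : SFiber x → ℂ) (γ : SFiber x) {T : Finset (SFiber x)}
    (hT : (finite_row f γ).toFinset ⊆ T) :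
    regFun f ξ γ = ∑ α ∈ T, f (mul γ.1 (inv α.1)) * ξ α := by
  refine finsum_eq_sum_of_support_subset _ fun α hα => hT ?_
  simpa using left_ne_zero_of_mul hα

lemma sum_regFun_le (f : Cc G) {x : G} (ξ : lp (fun _ : SFiber x => ℂ) 2)
    (S : Finset (SFiber x)) :
    ∑ γ ∈ S, ‖regFun f ξ γ‖ ^ 2 ≤ (iNorm f * ‖ξ‖) ^ 2 := by
  classical
  set T : Finset (SFiber x) := S.biUnion fun γ => (finite_row f γ).toFinset
  have hI := iNorm_nonneg f
  have h1 : ∀ γ ∈ S, ‖regFun f ξ γ‖ ^ 2 ≤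
      iNorm f * ∑ α ∈ T, ‖f (mul γ.1 (inv α.1))‖ * ‖ξ α‖ ^ 2 := by
    intro γ hγ
    rw [regFun_eq_sum f ξ γ (Finset.subset_biUnion_of_mem (fun γ => (finite_row f γ).toFinset) hγ)]
    calc ‖∑ α ∈ T, f (mul γ.1 (inv α.1)) * ξ α‖ ^ 2
        ≤ (∑ α ∈ T, ‖f (mul γ.1 (inv α.1))‖ * ‖ξ α‖) ^ 2 := by
          gcongr
          exact (norm_sum_le _ _).trans (le_of_eq (Finset.sum_congr rfl fun α _ => norm_mul _ _))
      _ ≤ (∑ α ∈ T, ‖f (mul γ.1 (inv α.1))‖) *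
            ∑ α ∈ T, ‖f (mul γ.1 (inv α.1))‖ * ‖ξ α‖ ^ 2 :=
          Finset.sum_sq_le_sum_mul_sum_of_sq_le_mul T (fun _ _ => norm_nonneg _)
            (fun _ _ => by positivity) (fun _ _ => le_of_eq (by ring))
      _ ≤ _ := by
          gcongr
          exact row_le f T γ
  have hξ : ∑ α ∈ T, ‖ξ α‖ ^ 2 ≤ ‖ξ‖ ^ 2 := by
    have := lp.sum_rpow_le_norm_rpow (p := 2) (by norm_num) ξ T
    simpa using this
  calc ∑ γ ∈ S, ‖regFun f ξ γ‖ ^ 2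
      ≤ ∑ γ ∈ S, iNorm f * ∑ α ∈ T, ‖f (mul γ.1 (inv α.1))‖ * ‖ξ α‖ ^ 2 := Finset.sum_le_sum h1
    _ = iNorm f * ∑ α ∈ T, (∑ γ ∈ S, ‖f (mul γ.1 (inv α.1))‖) * ‖ξ α‖ ^ 2 := by
        rw [← Finset.mul_sum, Finset.sum_comm]
        simp_rw [Finset.sum_mul]
    _ ≤ iNorm f * ∑ α ∈ T, iNorm f * ‖ξ α‖ ^ 2 := by
        gcongr with α _
        exact column_le f S α
    _ = iNorm f ^ 2 * ∑ α ∈ T, ‖ξ α‖ ^ 2 := by rw [← Finset.mul_sum]; ring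
    _ ≤ iNorm f ^ 2 * ‖ξ‖ ^ 2 := by gcongr
    _ = _ := by ring

/-- The left regular representation `λ_x` on `ℓ²(G_x)`. -/
noncomputable def leftRegular (x : UnitSpace G) (f : Cc G) :
    lp (fun _ : SFiber (x : G) => ℂ) 2 →L[ℂ] lp (fun _ : SFiber (x : G) => ℂ) 2 :=
  LinearMap.mkContinuous
    { toFun := fun ξ => ⟨regFun f ξ, memℓp_gen' (C := (iNorm f * ‖ξ‖) ^ 2) fun S => by
        simpa using sum_regFun_le f ξ S⟩
      map_add' := fun ξ η => by
        ext γ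
        have h : ∀ ζ : SFiber (x : G) → ℂ, _ := fun ζ => regFun_eq_sum f ζ γ subset_rfl
        simp only [lp.coeFn_add, Pi.add_apply, h, mul_add, Finset.sum_add_distrib]
      map_smul' := fun c ξ => by
        ext γ
        have h : ∀ ζ : SFiber (x : G) → ℂ, _ := fun ζ => regFun_eq_sum f ζ γ subset_rfl
        simp only [lp.coeFn_smul, Pi.smul_apply, h, smul_eq_mul, RingHom.id_apply,
          Finset.mul_sum, mul_left_comm] }
    (iNorm f) fun ξ => by
      refine lp.norm_le_of_forall_sum_le (by norm_num)
        (mul_nonneg (iNorm_nonneg f) (norm_nonneg _)) fun S => ?_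
      simpa using sum_regFun_le f ξ S

lemma leftRegular_apply (x : UnitSpace G) (f : Cc G) (ξ : lp (fun _ : SFiber (x : G) => ℂ) 2)
    (γ : SFiber (x : G)) :
    leftRegular x f ξ γ = ∑ᶠ α : SFiber (x : G), f (mul γ.1 (inv α.1)) * ξ α := rfl

/-- The reduced norm: the supremum of `‖λ_x(f)‖` over the units `x`. -/
noncomputable def reducedNorm (f : Cc G) : ℝ := ⨆ x : UnitSpace G, ‖leftRegular x f‖

lemma norm_leftRegular_le (x : UnitSpace G) (f : Cc G) : ‖leftRegular x f‖ ≤ iNorm f :=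
  LinearMap.mkContinuous_norm_le _ (iNorm_nonneg f) _

/-- The values `‖π(f)‖`, where `π` runs through the `*`-representations of `C_c(G)` on Hilbert
spaces that are contractive for the `I`-norm, that is, the restrictions to `C_c(G)` of the
contractive `*`-representations of its completion `L¹(G)`. -/
def representationNorms (f : Cc G) : Set ℝ :=
  {c | ∃ (H : Type u) (_ : NormedAddCommGroup H) (_ : InnerProductSpace ℂ H)
    (_ : CompleteSpace H) (π : Cc G →⋆ₙₐ[ℂ] (H →L[ℂ] H)),
    (∀ g : Cc G, ‖π g‖ ≤ iNorm g) ∧ c = ‖π f‖}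

/-- The maximal norm. -/
noncomputable def maximalNorm (f : Cc G) : ℝ := sSup (representationNorms f)

end Norms

/-! ### `C*`-norms on `C_c(G)` and their completions -/

section Completion

variable (G) in
/-- A `C*`-norm on the `*`-algebra `C_c(G)`. -/
structure CStarNorm [GroupoidStructure G] [EtaleGroupoid G] [T2Space G] extends
    AddGroupNorm (Cc G) where
  smul' : ∀ (c : ℂ) (f : Cc G), toFun (c • f) = ‖c‖ * toFun f
  mul_le' : ∀ f g : Cc G, toFun (f * g) ≤ toFun f * toFun g
  star_mul_self' : ∀ f : Cc G, toFun (star f * f) = toFun f ^ 2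

variable [GroupoidStructure G] [EtaleGroupoid G] [T2Space G]

namespace CStarNorm

instance : CoeFun (CStarNorm G) fun _ => Cc G → ℝ := ⟨fun ν => ν.toFun⟩

/-- The norm dominates the reduced norm. -/
def DominatesReduced (ν : CStarNorm G) : Prop := ∀ f, reducedNorm f ≤ ν f

/-- The `*`-algebra `C_c(G)`, normed by `ν`. -/
def Alg (_ : CStarNorm G) : Type u := Cc G

variable [CompactSpace (UnitSpace G)] (ν : CStarNorm G)

noncomputable instance : Ring ν.Alg := inferInstanceAs (Ring (Cc G))
noncomputable instance : StarRing ν.Alg := inferInstanceAs (StarRing (Cc G))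
noncomputable instance : Algebra ℂ ν.Alg := inferInstanceAs (Algebra ℂ (Cc G))
instance : StarModule ℂ ν.Alg := inferInstanceAs (StarModule ℂ (Cc G))

noncomputable instance : NormedRing ν.Alg where
  __ := (inferInstance : Ring ν.Alg)
  __ := AddGroupNorm.toNormedAddCommGroup (E := Cc G) ν.toAddGroupNorm
  norm_mul_le f g := ν.mul_le' f g

noncomputable instance : NormedAlgebra ℂ ν.Alg where
  norm_smul_le c f := (ν.smul' c f).le

instance : CStarRing ν.Alg where
  norm_mul_self_le f := by
    have h : ‖star f * f‖ = ‖f‖ ^ 2 := ν.star_mul_self' f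
    rw [h, sq]

/-- The groupoid `C*`-algebra `C*_ν(G)`. -/
abbrev Completion : Type u := UniformSpace.Completion ν.Alg

/-- The inclusion of the continuous functions on the unit space into `C*_ν(G)`. -/
noncomputable def unitFunction (f : C(UnitSpace G, ℂ)) : ν.Completion :=
  UniformSpace.Completion.coe' (α := ν.Alg) (Cc.inclusion f)

end CStarNorm

end Completion

end Cc

/-! ### Bisections, invariant measures and essential freeness -/

section Measures

variable {G : Type u} [GroupoidStructure G] [TopologicalSpace G]

/-- A bisection: source and range restrict to homeomorphisms of `B` onto the images. -/
def IsBisection (B : Set G) : Prop :=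
  Topology.IsEmbedding (B.domRestrict s) ∧ Topology.IsEmbedding (B.domRestrict r)

/-- The homeomorphism `α_B : s(B) → r(B)`, `x ↦ r ((s|_B)⁻¹ x)`, of a bisection `B`. -/
noncomputable def bisectionHomeo {B : Set G} (hB : IsBisection B) : s '' B ≃ₜ r '' B :=
  (Homeomorph.setCongr (Set.range_domRestrict s B)).symm.trans
    (hB.1.toHomeomorph.symm.trans
      (hB.2.toHomeomorph.trans (Homeomorph.setCongr (Set.range_domRestrict r B))))

/-- The fixed points of `α_B`. -/
def fixedPoints {B : Set G} (hB : IsBisection B) : Set (UnitSpace G) :=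
  {x | ∃ hx : x ∈ s '' B, (bisectionHomeo hB ⟨x, hx⟩ : UnitSpace G) = x}

variable [MeasurableSpace G]

/-- A measure on the unit space is invariant if `α_B` pushes its restriction to `s(B)` forward to
its restriction to `r(B)`, for every open bisection `B`. -/
def IsInvariantMeasure (μ : MeasureTheory.Measure (UnitSpace G)) : Prop :=
  ∀ (B : Set G) (hB : IsBisection B), IsOpen B →
    (μ.comap (Subtype.val : s '' B → UnitSpace G)).map (bisectionHomeo hB) =
      μ.comap (Subtype.val : r '' B → UnitSpace G)

variable (G) in
/-- The set `M(G)` of invariant probability Radon measures on the unit space. -/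
def invariantMeasures : Set (MeasureTheory.FiniteMeasure (UnitSpace G)) :=
  {μ | MeasureTheory.IsProbabilityMeasure (μ : MeasureTheory.Measure (UnitSpace G)) ∧
    (μ : MeasureTheory.Measure (UnitSpace G)).Regular ∧
    IsInvariantMeasure (μ : MeasureTheory.Measure (UnitSpace G))}

/-- Essential freeness with respect to a measure: `μ (Fix α_B) = 0` for every pre-compact open
bisection `B` that contains no units. -/
def EssentiallyFreeFor (μ : MeasureTheory.Measure (UnitSpace G)) : Prop :=
  ∀ (B : Set G) (hB : IsBisection B), IsOpen B → IsCompact (closure B) → Disjoint B (units G) →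
    μ (fixedPoints hB) = 0

variable (G) in
/-- Essential freeness: essential freeness with respect to all invariant probability Radon
measures on the unit space. -/
def EssentiallyFree : Prop :=
  ∀ μ ∈ invariantMeasures G, EssentiallyFreeFor (μ : MeasureTheory.Measure (UnitSpace G))

variable [EtaleGroupoid G] [T2Space G] [CompactSpace (UnitSpace G)]

/-- `μ` is the measure associated with the functional `τ` on `C*_ν(G)`: the probability Radon
measure on the unit space with `τ(f) = ∫ f dμ` for all continuous functions `f` on it. -/
def IsAssociatedMeasure {ν : CStarNorm G} (τ : WeakDual ℂ ν.Completion)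
    (μ : MeasureTheory.FiniteMeasure (UnitSpace G)) : Prop :=
  MeasureTheory.IsProbabilityMeasure (μ : MeasureTheory.Measure (UnitSpace G)) ∧
    (μ : MeasureTheory.Measure (UnitSpace G)).Regular ∧
    ∀ f : C(UnitSpace G, ℂ),
      τ (ν.unitFunction f) = ∫ x, f x ∂(μ : MeasureTheory.Measure (UnitSpace G))

/-- The assertion that `τ ↦ μ_τ` is a well-defined affine homeomorphism from the tracial state space
of `C*_ν(G)` onto `M(G)` (weak-`*` topologies), which identifies the extreme boundaries. -/
def TracesAreInvariantMeasures [BorelSpace G] (ν : CStarNorm G) : Prop :=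
  Convex ℝ (tracialStates ν.Completion) ∧ Convex ℝ≥0 (invariantMeasures G) ∧
  ∃ Φ : tracialStates ν.Completion ≃ₜ invariantMeasures G,
    (∀ (τ : tracialStates ν.Completion) (μ : MeasureTheory.FiniteMeasure (UnitSpace G)),
      IsAssociatedMeasure τ.1 μ ↔ μ = (Φ τ).1) ∧
    (∀ (τ₁ τ₂ τ : tracialStates ν.Completion) (a b : ℝ≥0), a + b = 1 →
      τ.1 = (a : ℝ) • τ₁.1 + (b : ℝ) • τ₂.1 → (Φ τ).1 = a • (Φ τ₁).1 + b • (Φ τ₂).1) ∧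
    (∀ τ : tracialStates ν.Completion,
      τ.1 ∈ (tracialStates ν.Completion).extremePoints ℝ ↔
        (Φ τ).1 ∈ (invariantMeasures G).extremePoints ℝ≥0)

end Measures

end GroupoidStructure

/-!
Restriction to the unit space is a conditional expectation of `C_c(G)` onto `C(G⁰)`. The restriction
of `f * g` is the sum of `f(α⁻¹) g(α)` over the arrows `α` with a given source, and the restriction
of `g * f` is the same sum over the arrows with a given range. A regular measure `μ` is invariant
exactly when the integrals of source sums and range sums agree: by a partition of unity this need
only be tested on bisections. Hence `f ↦ ∫ f|_{G⁰} dμ` is a trace for invariant `μ`, and it extends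
to `C*_ν(G)` because `|f| ≤ ‖f‖_r` pointwise. Conversely, the measure of a trace is invariant: if
`g` is supported in a bisection and `b`, supported there too, equals `1` on the support of `g`, then
`b* * g` and `g * b*` are the source sums and the range sums of `g`.

A trace `τ` is determined by its measure `μ` as soon as it vanishes on the functions `f` supported
in a small bisection away from the units. A trace vanishes on functions supported where `s ≠ r`, by
multiplying with an Urysohn function that is `1` near the range and `0` near the source. So `f` may
be multiplied by a function supported near the fixed points, and Cauchy–Schwarz bounds `|τ(f)|²` by
a multiple of the measure of a small neighbourhood of the fixed points, which are null by essential
freeness.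
-/

namespace GroupoidStructure

section Algebra

variable {G : Type u} [GroupoidStructure G] {a b : G}

lemma inv_mul_cancel_left' (h : src a = rng b) : mul (inv a) (mul a b) = b := by
  rw [← mul_assoc _ _ _ (src_inv a) h, inv_mul, h, rng_mul_self]

lemma inv_mem_units : inv a ∈ units G ↔ a ∈ units G :=
  ⟨fun h => by rwa [← inv_inv' a, inv_of_mem_units h], fun h => by rwa [inv_of_mem_units h]⟩

lemma right_mem_units_of_mul_eq_left (h : src a = rng b) (hab : mul a b = a) : b ∈ units G := by
  have hb : src a = b := by rw [← inv_mul, ← inv_mul_cancel_left' h, hab]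
  rw [← hb]
  exact src_src a

lemma left_mem_units_of_mul_eq_right (h : src a = rng b) (hab : mul a b = b) : a ∈ units G := by
  have ha : rng b = a := by rw [← mul_inv, ← mul_inv_cancel_right' h, hab]
  rw [← ha]
  exact src_rng b

end Algebra

namespace Cc

section Localization

variable {E : Type u} [TopologicalSpace E]

lemma coe_sum {ι : Type*} (t : Finset ι) (f : ι → Cc E) : ⇑(∑ i ∈ t, f i) = ∑ i ∈ t, ⇑(f i) :=
  map_sum ({ toFun := (⇑), map_zero' := rfl, map_add' := fun _ _ => rfl } : Cc E →+ E → ℂ) f t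

/-- The pointwise product of a continuous function and a compactly supported one. -/
noncomputable def smulFun (φ : C(E, ℂ)) (f : Cc E) : Cc E :=
  of (φ * f) (φ.continuous.mul f.continuous) f.hasCompactSupport.mul_left

variable [T2Space E] [LocallyCompactSpace E]

lemma exists_eq_sum_tsupport_subset (f : Cc E) {U : E → Set E}
    (hU : ∀ e ∈ tsupport f, U e ∈ 𝓝 e) :
    ∃ (n : ℕ) (e : Fin n → E) (g : Fin n → Cc E),
      (∀ i, e i ∈ tsupport f) ∧ (∀ i, tsupport (g i) ⊆ U (e i)) ∧ f = ∑ i, g i := by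
  obtain ⟨t, ht, hcov⟩ := f.hasCompactSupport.elim_nhds_subcover (fun e => interior (U e))
    fun e he => interior_mem_nhds.2 (hU e he)
  let e : Fin t.card → E := fun i => t.equivFin.symm i
  have hcov' : tsupport f ⊆ ⋃ i, interior (U (e i)) := by
    intro x hx
    obtain ⟨y, hy, hxy⟩ := Set.mem_iUnion₂.1 (hcov hx)
    exact Set.mem_iUnion.2 ⟨t.equivFin ⟨y, hy⟩, by simpa [e] using hxy⟩
  obtain ⟨φ, hφU, hφ1, -, -⟩ := exists_continuous_sum_one_of_isOpen_isCompact
    (fun _ => isOpen_interior) f.hasCompactSupport hcov'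
  let ψ : Fin t.card → C(E, ℂ) := fun i => ⟨fun x => (φ i x : ℂ), by fun_prop⟩
  refine ⟨t.card, e, fun i => smulFun (ψ i) f, fun i => ht _ (t.equivFin.symm i).2, fun i => ?_,
    coe_inj (funext fun x => ?_)⟩
  · have hsupp : Function.support (smulFun (ψ i) f) ⊆ Function.support (φ i) := fun x hx =>
      Complex.ofReal_ne_zero.1 (left_ne_zero_of_mul hx)
    exact (closure_mono hsupp).trans ((hφU i).trans interior_subset)
  · have hsum : (∑ i, ⇑(smulFun (ψ i) f)) x = (∑ i, (φ i x : ℂ)) * f x := by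
      rw [Finset.sum_apply, Finset.sum_mul]
      rfl
    rw [coe_sum, hsum]
    by_cases hx : x ∈ tsupport f
    · have h1 : ∑ i, φ i x = 1 := by
        simpa only [Finset.sum_apply, Pi.one_apply] using hφ1 hx
      rw [← Complex.ofReal_sum, h1, Complex.ofReal_one, one_mul]
    · rw [image_eq_zero_of_notMem_tsupport hx, mul_zero]

lemma map_eq_map_of_locally {M F₁ F₂ : Type*} [AddCommMonoid M]
    [FunLike F₁ (Cc E) M] [AddMonoidHomClass F₁ (Cc E) M]
    [FunLike F₂ (Cc E) M] [AddMonoidHomClass F₂ (Cc E) M] (L₁ : F₁) (L₂ : F₂) (f : Cc E)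
    (h : ∀ e ∈ tsupport f, ∃ U ∈ 𝓝 e, ∀ g : Cc E, tsupport g ⊆ U → L₁ g = L₂ g) :
    L₁ f = L₂ f := by
  choose! U hU hL using h
  obtain ⟨n, e, g, he, hg, hf⟩ := f.exists_eq_sum_tsupport_subset hU
  rw [hf, map_sum, map_sum]
  exact Finset.sum_congr rfl fun i _ => hL _ (he i) _ (hg i)

end Localization

section Push

variable {E : Type u} {X : Type*} [TopologicalSpace E] [TopologicalSpace X] [T2Space X]
  {p : E → X} (hp : IsLocalHomeomorph p)

include hp in
lemma finite_preimage_inter_support (k : Cc E) (x : X) :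
    (p ⁻¹' {x} ∩ Function.support k).Finite :=
  (finite_fiber_inter hp k.hasCompactSupport x).subset
    (Set.inter_subset_inter_right _ (subset_tsupport _))

variable [T2Space E]

/-- The push-forward of a compactly supported function along a local homeomorphism `p`: its sums
over the fibres of `p`. -/
noncomputable def push : Cc E →ₗ[ℂ] C(X, ℂ) where
  toFun k := ⟨fun x => ∑ᶠ e ∈ p ⁻¹' {x}, k e, continuous_push hp k.continuous k.hasCompactSupport⟩
  map_add' f g := ContinuousMap.ext fun x => finsum_mem_add_distrib'
    (finite_preimage_inter_support hp f x) (finite_preimage_inter_support hp g x)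
  map_smul' c f := ContinuousMap.ext fun x => by
    simp only [coe_smul, Pi.smul_apply, ContinuousMap.coe_mk, ContinuousMap.coe_smul,
      RingHom.id_apply, smul_finsum]

lemma push_apply (k : Cc E) (x : X) : push hp k x = ∑ᶠ e ∈ p ⁻¹' {x}, k e := rfl

variable {B : Set E} {k : Cc E} (hk : Function.support k ⊆ B)

include hk in
lemma push_apply_of_injOn (hB : Set.InjOn p B) {b : E} (hb : b ∈ B) :
    push hp k (p b) = k b := by
  rw [push_apply, ← finsum_mem_singleton (a := b) (f := k)]
  refine finsum_mem_inter_support_eq _ _ _ (Set.ext fun e => and_congr_left fun he => ?_)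
  exact ⟨fun h => hB (hk he) hb h, congrArg p⟩

include hk in
lemma push_apply_of_notMem {x : X} (hx : x ∉ p '' B) : push hp k x = 0 := by
  refine finsum_mem_eq_zero_of_forall_eq_zero fun e he => ?_
  by_contra hne
  exact hx ⟨e, hk hne, he⟩

end Push

section UnitSpace

variable {G : Type u} [TopologicalSpace G] [GroupoidStructure G]

variable (G) in
/-- The restriction of functions to the unit space; this is the canonical conditional
expectation. -/
def restrictUnits : Cc G →ₗ[ℂ] C(UnitSpace G, ℂ) where
  toFun f := ⟨fun x => f x, f.continuous.comp continuous_subtype_val⟩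
  map_add' _ _ := rfl
  map_smul' _ _ := rfl

@[simp] lemma restrictUnits_apply (f : Cc G) (x : UnitSpace G) : restrictUnits G f x = f x := rfl

lemma ext_units {f g : Cc G} (h : ∀ x : UnitSpace G, f x = g x) (h' : ∀ γ ∉ units G, f γ = g γ) :
    f = g :=
  coe_inj (funext fun γ => (em (γ ∈ units G)).elim (fun hγ => h ⟨γ, hγ⟩) (h' γ))

variable [EtaleGroupoid G]

/-- The pointwise product of `f ∘ inv` and `g`, whose sums over the fibres of `s` and `r` are the
restrictions of `f * g` and `g * f` to the unit space. -/
noncomputable def invCompMul (f g : Cc G) : Cc G :=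
  of (fun α => f (inv α) * g α)
    ((f.continuous.comp EtaleGroupoid.continuous_inv).mul g.continuous)
    g.hasCompactSupport.mul_left

lemma invCompMul_apply (f g : Cc G) (α : G) : invCompMul f g α = f (inv α) * g α := rfl

lemma invCompMul_star (f g : Cc G) (α : G) : invCompMul (star f) g α = star (f α) * g α := by
  rw [invCompMul_apply, coe_star, involution, inv_inv']

lemma invCompMul_star_eq_right {b g : Cc G} (hbg : Set.EqOn b 1 (Function.support g)) :
    invCompMul (star b) g = g := by
  refine coe_inj (funext fun γ => ?_)
  rw [invCompMul_star]
  by_cases hγ : g γ = 0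
  · rw [hγ, mul_zero]
  · rw [hbg hγ, Pi.one_apply, star_one, one_mul]

variable [T2Space G]

variable (G) in
/-- The sums over the arrows with given source. -/
noncomputable abbrev sourceSum : Cc G →ₗ[ℂ] C(UnitSpace G, ℂ) := push isLocalHomeomorph_s

variable (G) in
/-- The sums over the arrows with given range. -/
noncomputable abbrev rangeSum : Cc G →ₗ[ℂ] C(UnitSpace G, ℂ) :=
  push EtaleGroupoid.isLocalHomeomorph_r

lemma restrictUnits_mul_eq_sourceSum (f g : Cc G) :
    restrictUnits G (f * g) = sourceSum G (invCompMul f g) := by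
  ext x
  have hfib : (s : G → UnitSpace G) ⁻¹' {x} = {α : G | src α = (x : G)} :=
    Set.ext fun α => Subtype.ext_iff
  rw [restrictUnits_apply, coe_mul, conv_eq f g x.2, push_apply, hfib]
  refine (finsum_subtype_eq_finsum_cond (f := fun α => f (mul x.1 (inv α)) * g α)
    (fun α : G => src α = x)).trans (finsum_mem_congr rfl fun α hα => ?_)
  have hα' : mul x.1 (inv α) = inv α := by
    rw [← show src α = x.1 from hα, ← rng_inv, rng_mul_self]
  rw [hα', invCompMul_apply]

lemma sourceSum_invCompMul_comm (f g : Cc G) :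
    sourceSum G (invCompMul g f) = rangeSum G (invCompMul f g) := by
  ext x
  refine finsum_mem_eq_of_bijOn inv ⟨fun α hα => ?_, ?_, fun α hα => ⟨inv α, ?_, inv_inv' α⟩⟩
    fun α _ => ?_
  · exact (Subtype.ext (rng_inv α)).trans hα
  · exact (Function.LeftInverse.injective inv_inv').injOn
  · exact (Subtype.ext (src_inv α)).trans hα
  · rw [invCompMul_apply, invCompMul_apply, inv_inv', mul_comm]

lemma restrictUnits_mul_eq_rangeSum (f g : Cc G) :
    restrictUnits G (g * f) = rangeSum G (invCompMul f g) := by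
  rw [restrictUnits_mul_eq_sourceSum, sourceSum_invCompMul_comm]

lemma restrictUnits_star_mul_self_nonneg (f : Cc G) (x : UnitSpace G) :
    0 ≤ restrictUnits G (star f * f) x := by
  rw [restrictUnits_mul_eq_sourceSum, push_apply]
  refine finsum_nonneg fun α => finsum_nonneg fun _ => ?_
  rw [invCompMul_star]
  exact star_mul_self_nonneg _

lemma star_mul_apply_eq_zero {f g : Cc G} {B : Set G} (hB : Set.InjOn (r : G → UnitSpace G) B)
    (hf : Function.support f ⊆ B) (hg : Function.support g ⊆ B) {γ : G} (hγ : γ ∉ units G) :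
    (star f * g) γ = 0 := by
  rw [coe_mul, conv]
  refine finsum_eq_zero_of_forall_eq_zero fun α => ?_
  by_contra hne
  have hfα : f (mul α.1 (inv γ)) ≠ 0 := fun h0 => left_ne_zero_of_mul hne <| by
    rw [coe_star, involution, inv_mul_inv α.2.symm, h0, star_zero]
  have hc : src α.1 = rng (inv γ) := by rw [rng_inv, α.2]
  exact hγ (inv_mem_units.1 (right_mem_units_of_mul_eq_left hc
    (hB (hf hfα) (hg (right_ne_zero_of_mul hne)) (Subtype.ext (rng_mul _ _ hc)))))

lemma mul_star_apply_eq_zero {f g : Cc G} {B : Set G} (hB : Set.InjOn (s : G → UnitSpace G) B)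
    (hf : Function.support f ⊆ B) (hg : Function.support g ⊆ B) {γ : G} (hγ : γ ∉ units G) :
    (f * star g) γ = 0 := by
  rw [coe_mul, conv]
  refine finsum_eq_zero_of_forall_eq_zero fun α => ?_
  by_contra hne
  have hgα : g (inv α.1) ≠ 0 := fun h0 => right_ne_zero_of_mul hne <| by
    rw [coe_star, involution, h0, star_zero]
  have hc : src γ = rng (inv α.1) := by rw [rng_inv, α.2]
  exact hγ (left_mem_units_of_mul_eq_right hc
    (hB (hf (left_ne_zero_of_mul hne)) (hg hgα) (Subtype.ext (src_mul _ _ hc))))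

variable [CompactSpace (UnitSpace G)]

lemma inclusion_apply (f : C(UnitSpace G, ℂ)) (x : UnitSpace G) : inclusion f x = f x := by
  change (units G).indicator (fun γ => f (s γ)) x = f x
  rw [Set.indicator_of_mem x.2]
  exact congrArg f (Subtype.ext x.2)

lemma inclusion_apply_of_notMem (f : C(UnitSpace G, ℂ)) {γ : G} (h : γ ∉ units G) :
    inclusion f γ = 0 := by
  change (units G).indicator (fun γ => f (s γ)) γ = 0
  exact Set.indicator_of_notMem h _

lemma restrictUnits_inclusion (f : C(UnitSpace G, ℂ)) : restrictUnits G (inclusion f) = f :=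
  ContinuousMap.ext (inclusion_apply f)

lemma eq_inclusion_restrictUnits {f : Cc G} (h : ∀ γ ∉ units G, f γ = 0) :
    f = inclusion (restrictUnits G f) :=
  ext_units (fun x => (inclusion_apply (restrictUnits G f) x).symm) fun γ hγ => by
    rw [h γ hγ, inclusion_apply_of_notMem _ hγ]

lemma inclusion_mul_apply (f : C(UnitSpace G, ℂ)) (g : Cc G) (γ : G) :
    (inclusion f * g) γ = f (r γ) * g γ :=
  (congrFun (conv_indicator_left (fun γ => f (s γ)) g) γ).trans
    (congrArg (fun x => f x * g γ) (Subtype.ext (src_rng γ)))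

lemma mul_inclusion_apply (f : C(UnitSpace G, ℂ)) (g : Cc G) (γ : G) :
    (g * inclusion f) γ = g γ * f (s γ) :=
  (congrFun (conv_indicator_right (fun γ => f (s γ)) g) γ).trans
    (congrArg (fun x => g γ * f x) (Subtype.ext (src_src γ)))

lemma inclusion_add (f g : C(UnitSpace G, ℂ)) :
    inclusion (f + g) = inclusion f + inclusion g := by
  refine ext_units (fun x => ?_) fun γ hγ => ?_
  · rw [coe_add, Pi.add_apply, inclusion_apply, inclusion_apply, inclusion_apply,
      ContinuousMap.add_apply]
  · rw [coe_add, Pi.add_apply, inclusion_apply_of_notMem _ hγ, inclusion_apply_of_notMem _ hγ,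
      inclusion_apply_of_notMem _ hγ, add_zero]

lemma inclusion_smul (c : ℂ) (f : C(UnitSpace G, ℂ)) :
    inclusion (c • f) = c • inclusion f := by
  refine ext_units (fun x => ?_) fun γ hγ => ?_
  · rw [coe_smul, Pi.smul_apply, inclusion_apply, inclusion_apply, ContinuousMap.smul_apply]
  · rw [coe_smul, Pi.smul_apply, inclusion_apply_of_notMem _ hγ, inclusion_apply_of_notMem _ hγ,
      smul_zero]

lemma inclusion_mul (f g : C(UnitSpace G, ℂ)) :
    inclusion (f * g) = inclusion f * inclusion g := by
  refine ext_units (fun x => ?_) fun γ hγ => ?_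
  · have hr : r x.1 = x := Subtype.ext (rng_of_mem_units x.2)
    rw [inclusion_mul_apply, inclusion_apply, inclusion_apply, hr, ContinuousMap.mul_apply]
  · rw [inclusion_mul_apply, inclusion_apply_of_notMem _ hγ, inclusion_apply_of_notMem _ hγ,
      mul_zero]

lemma inclusion_star (f : C(UnitSpace G, ℂ)) : inclusion (star f) = star (inclusion f) := by
  refine ext_units (fun x => ?_) fun γ hγ => ?_
  · rw [coe_star, involution, inv_of_mem_units x.2, inclusion_apply, inclusion_apply,
      ContinuousMap.star_apply]
  · rw [coe_star, involution, inclusion_apply_of_notMem _ hγ,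
      inclusion_apply_of_notMem _ (mt inv_mem_units.1 hγ), star_zero]

variable (G) in
/-- The inclusion of the functions on the unit space, as a unital `*`-homomorphism. -/
noncomputable def inclusionHom : C(UnitSpace G, ℂ) →⋆ₐ[ℂ] Cc G where
  __ := AlgHom.ofLinearMap
    { toFun := inclusion, map_add' := inclusion_add, map_smul' := inclusion_smul }
    rfl inclusion_mul
  map_star' := inclusion_star

end UnitSpace

end Cc

open MeasureTheory

section RegularMeasures

variable {X : Type*} [TopologicalSpace X] [MeasurableSpace X] [BorelSpace X]

lemma comap_val_comp_homeomorph {Y : Type*} [TopologicalSpace Y] [MeasurableSpace Y]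
    [BorelSpace Y] (μ : Measure X) {V : Set X} (hV : MeasurableSet V) (e : Y ≃ₜ V) :
    μ.comap (fun y => (e y : X)) = (μ.comap (Subtype.val : V → X)).map e.symm := by
  have hval := MeasurableEmbedding.subtype_coe hV
  have := Measure.comap_comap (fun _ => e.measurableEmbedding.measurableSet_image.2)
    hval.injective (fun _ => hval.measurableSet_image.2) μ
  exact this.symm.trans e.toMeasurableEquiv.map_symm.symm

section Compact

variable [CompactSpace X] (μ : Measure X) [IsFiniteMeasure μ]

lemma integrable_continuousMap (f : C(X, ℂ)) : Integrable f μ :=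
  f.continuous.integrable_of_hasCompactSupport (.of_compactSpace _)

/-- Integration of continuous functions against a finite measure on a compact space. -/
noncomputable def integralLinearMap : C(X, ℂ) →ₗ[ℂ] ℂ where
  toFun f := ∫ x, f x ∂μ
  map_add' f g := integral_add (integrable_continuousMap μ f) (integrable_continuousMap μ g)
  map_smul' c f := integral_smul c f

lemma integralLinearMap_apply (f : C(X, ℂ)) : integralLinearMap μ f = ∫ x, f x ∂μ := rfl

end Compact

variable [T2Space X]

lemma measure_ext_of_integral_compactlySupported [LocallyCompactSpace X] {μ μ' : Measure X}
    [μ.Regular] [μ'.Regular] (h : ∀ f : C_c(X, ℂ), ∫ x, f x ∂μ = ∫ x, f x ∂μ') : μ = μ' := by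
  refine Measure.ext_of_integral_eq_on_compactlySupported fun f => ?_
  have hf := h (f.compLeft ⟨Complex.ofReal, Complex.continuous_ofReal⟩)
  simp only [CompactlySupportedContinuousMap.coe_compLeft
    (g := ⟨Complex.ofReal, Complex.continuous_ofReal⟩) Complex.ofReal_zero, ContinuousMap.coe_mk,
    Function.comp_apply, integral_complex_ofReal] at hf
  exact Complex.ofReal_injective hf

lemma measure_ext_of_integral_continuousMap [CompactSpace X] {μ μ' : Measure X}
    [μ.Regular] [μ'.Regular] (h : ∀ f : C(X, ℂ), ∫ x, f x ∂μ = ∫ x, f x ∂μ') : μ = μ' :=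
  measure_ext_of_integral_compactlySupported fun f => h f.toContinuousMap

lemma exists_regular_integral_eq [CompactSpace X] (φ : C(X, ℂ) →ₚ[ℂ] ℂ) :
    ∃ μ : Measure X, IsFiniteMeasure μ ∧ μ.Regular ∧ ∀ f : C(X, ℂ), φ f = ∫ x, f x ∂μ := by
  let ι : C(X, ℝ) →L[ℝ] C(X, ℂ) := Complex.ofRealCLM.compLeftContinuous ℝ X
  let Λ : C_c(X, ℝ) →ₚ[ℝ] ℝ := .mk₀
    { toFun f := (φ (ι f.toContinuousMap)).re
      map_add' f g := by
        rw [← Complex.add_re, ← map_add, ← map_add]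
        rfl
      map_smul' c f := by
        change (φ (ι (c • f.toContinuousMap))).re = _
        rw [map_smul, ← Complex.coe_smul, map_smul, Complex.coe_smul, Complex.smul_re,
          RingHom.id_apply] }
    fun f hf => (Complex.le_def.1 (map_nonneg φ (a := ι f.toContinuousMap)
      fun x => Complex.zero_le_real.2 (hf x))).1
  have hreal (f : C(X, ℝ)) : φ (ι f) = ∫ x, ι f x ∂(RealRMK.rieszMeasure Λ) := by
    have hf : IsSelfAdjoint (φ (ι f)) :=
      IsSelfAdjoint.map' (ContinuousMap.ext fun x => Complex.conj_ofReal (f x)) φ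
    calc φ (ι f) = ((φ (ι f)).re : ℂ) := (Complex.conj_eq_iff_re.1 hf).symm
      _ = ((∫ x, f x ∂(RealRMK.rieszMeasure Λ) : ℝ) : ℂ) :=
        congrArg _ (RealRMK.integral_rieszMeasure Λ (.continuousMapEquiv f)).symm
      _ = ∫ x, ι f x ∂(RealRMK.rieszMeasure Λ) := integral_complex_ofReal.symm
  refine ⟨RealRMK.rieszMeasure Λ, inferInstance, inferInstance, fun f => ?_⟩
  have hf : f = ι ⟨fun x => (f x).re, by fun_prop⟩ +
      Complex.I • ι ⟨fun x => (f x).im, by fun_prop⟩ :=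
    ContinuousMap.ext fun x => by simp [ι, mul_comm Complex.I]
  rw [← integralLinearMap_apply, hf]
  simp only [map_add, map_smul, hreal, integralLinearMap_apply]

end RegularMeasures

section Push

variable {E : Type u} {X : Type*} [TopologicalSpace E] [TopologicalSpace X] {B : Set E}

/-- The extension by zero of a compactly supported function on an open set. -/
noncomputable def extendZero [T2Space E] (ho : IsOpen B) (f : C_c(B, ℂ)) : Cc E :=
  .of (Subtype.val.extend f 0) (f.hasCompactSupport.continuous_extend_zero ho f.continuous)
    (f.hasCompactSupport.extend_zero continuous_subtype_val)

lemma extendZero_apply [T2Space E] (ho : IsOpen B) (f : C_c(B, ℂ)) (b : B) :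
    extendZero ho f b = f b :=
  Subtype.val_injective.extend_apply _ _ _

lemma support_extendZero_subset [T2Space E] (ho : IsOpen B) (f : C_c(B, ℂ)) :
    Function.support (extendZero ho f) ⊆ B := fun e he => by
  by_contra h
  exact he (Function.extend_apply' _ _ _ fun ⟨b, hb⟩ => h (hb ▸ b.2))

variable {p q : E → X} (hp : IsLocalHomeomorph p) (hq : IsLocalHomeomorph q) (ho : IsOpen B)

include hp ho in
lemma isOpenEmbedding_domRestrict (hB : Set.InjOn p B) :
    Topology.IsOpenEmbedding (B.domRestrict p) :=
  .of_continuous_injective_isOpenMap (hp.continuous.comp continuous_subtype_val)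
    (Set.injOn_iff_injective.1 hB) (hp.isOpenMap.domRestrict ho)

variable [T2Space E] [T2Space X] [MeasurableSpace E] [BorelSpace E] [MeasurableSpace X]
  [BorelSpace X] (hpB : Set.InjOn p B) (hqB : Set.InjOn q B)

include ho hpB in
lemma integral_push_of_injOn (μ : Measure X) {k : Cc E} (hk : Function.support k ⊆ B) :
    ∫ x, Cc.push hp k x ∂μ = ∫ b : B, k b ∂(μ.comap (B.domRestrict p)) := by
  have hemb := (isOpenEmbedding_domRestrict hp ho hpB).measurableEmbedding
  have hkb (b : B) : k b = Cc.push hp k (B.domRestrict p b) :=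
    (Cc.push_apply_of_injOn hp hk hpB b.2).symm
  simp_rw [hkb]
  rw [← hemb.integral_map, hemb.map_comap, setIntegral_eq_integral_of_forall_compl_eq_zero]
  intro x hx
  exact Cc.push_apply_of_notMem hp hk (by rwa [Set.range_domRestrict] at hx)

include ho hpB hqB in
lemma comap_domRestrict_eq_iff_integral_push [LocallyCompactSpace E] (μ : Measure X) [μ.Regular] :
    μ.comap (B.domRestrict p) = μ.comap (B.domRestrict q) ↔
      ∀ k : Cc E, Function.support k ⊆ B →
        ∫ x, Cc.push hp k x ∂μ = ∫ x, Cc.push hq k x ∂μ := by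
  refine ⟨fun h k hk => ?_, fun h => ?_⟩
  · rw [integral_push_of_injOn hp ho hpB μ hk, integral_push_of_injOn hq ho hqB μ hk, h]
  · have : LocallyCompactSpace B := ho.locallyCompactSpace
    have := Measure.Regular.comap' μ (isOpenEmbedding_domRestrict hp ho hpB)
    have := Measure.Regular.comap' μ (isOpenEmbedding_domRestrict hq ho hqB)
    refine measure_ext_of_integral_compactlySupported fun f => ?_
    have hf := support_extendZero_subset ho f
    simpa only [integral_push_of_injOn hp ho hpB μ hf, integral_push_of_injOn hq ho hqB μ hf,
      extendZero_apply] using h _ hf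

end Push

section Bisection

variable {G : Type u} [TopologicalSpace G] [GroupoidStructure G] {B : Set G}

/-- The homeomorphism of a bisection onto its image under the source map. -/
noncomputable def sourceHomeo (hB : IsBisection B) : B ≃ₜ s '' B :=
  hB.1.toHomeomorph.trans (Homeomorph.setCongr (Set.range_domRestrict s B))

/-- The homeomorphism of a bisection onto its image under the range map. -/
noncomputable def rangeHomeo (hB : IsBisection B) : B ≃ₜ r '' B :=
  hB.2.toHomeomorph.trans (Homeomorph.setCongr (Set.range_domRestrict r B))

lemma bisectionHomeo_apply (hB : IsBisection B) {b : G} (hb : b ∈ B) :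
    (bisectionHomeo hB ⟨s b, b, hb, rfl⟩ : UnitSpace G) = r b :=
  congrArg (fun b' => (rangeHomeo hB b' : UnitSpace G))
    ((sourceHomeo hB).symm_apply_apply ⟨b, hb⟩)

lemma IsBisection.injOn_s (hB : IsBisection B) : Set.InjOn s B :=
  Set.injOn_iff_injective.2 hB.1.injective

lemma IsBisection.injOn_r (hB : IsBisection B) : Set.InjOn r B :=
  Set.injOn_iff_injective.2 hB.2.injective

variable [EtaleGroupoid G]

lemma IsBisection.of_injOn (ho : IsOpen B) (hs : Set.InjOn s B) (hr : Set.InjOn r B) :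
    IsBisection B :=
  ⟨(isOpenEmbedding_domRestrict isLocalHomeomorph_s ho hs).isEmbedding,
    (isOpenEmbedding_domRestrict EtaleGroupoid.isLocalHomeomorph_r ho hr).isEmbedding⟩

lemma IsBisection.mono (hB : IsBisection B) {B' : Set G} (ho : IsOpen B') (h : B' ⊆ B) :
    IsBisection B' :=
  .of_injOn ho (hB.injOn_s.mono h) (hB.injOn_r.mono h)

lemma exists_isBisection_mem_nhds (γ : G) : ∃ B : Set G, IsOpen B ∧ γ ∈ B ∧ IsBisection B := by
  obtain ⟨e, he, hs⟩ := isLocalHomeomorph_s γ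
  obtain ⟨e', he', hr⟩ := EtaleGroupoid.isLocalHomeomorph_r γ
  have ho := e.open_source.inter e'.open_source
  refine ⟨e.source ∩ e'.source, ho, ⟨he, he'⟩, .of_injOn ho ?_ ?_⟩
  · rw [hs]
    exact e.injOn.mono Set.inter_subset_left
  · rw [hr]
    exact e'.injOn.mono Set.inter_subset_right

variable [MeasurableSpace G] [BorelSpace G]

lemma isInvariantMeasure_iff_comap (μ : Measure (UnitSpace G)) :
    IsInvariantMeasure μ ↔ ∀ B : Set G, IsBisection B → IsOpen B →
      μ.comap (B.domRestrict s) = μ.comap (B.domRestrict r) := by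
  refine forall_congr' fun B => forall_congr' fun hB => forall_congr' fun ho => ?_
  have hs : μ.comap (B.domRestrict s) = _ := comap_val_comp_homeomorph μ
    (isLocalHomeomorph_s.isOpenMap _ ho).measurableSet (sourceHomeo hB)
  have hr : μ.comap (B.domRestrict r) = _ := comap_val_comp_homeomorph μ
    (EtaleGroupoid.isLocalHomeomorph_r.isOpenMap _ ho).measurableSet (rangeHomeo hB)
  have hcomp : (μ.comap (Subtype.val : s '' B → UnitSpace G)).map (bisectionHomeo hB) = _ :=
    (Measure.map_map (rangeHomeo hB).measurable (sourceHomeo hB).symm.measurable).symm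
  rw [hs, hr, hcomp]
  exact (rangeHomeo hB).toMeasurableEquiv.map_apply_eq_iff_map_symm_apply_eq

variable [T2Space G] [LocallyCompactSpace G] [CompactSpace (UnitSpace G)]

lemma isInvariantMeasure_iff_integral (μ : Measure (UnitSpace G)) [IsFiniteMeasure μ]
    [μ.Regular] :
    IsInvariantMeasure μ ↔
      ∀ k : Cc G, ∫ x, Cc.sourceSum G k x ∂μ = ∫ x, Cc.rangeSum G k x ∂μ := by
  have hcomap (B : Set G) (hB : IsBisection B) (ho : IsOpen B) :=
    comap_domRestrict_eq_iff_integral_push isLocalHomeomorph_s EtaleGroupoid.isLocalHomeomorph_r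
      ho hB.injOn_s hB.injOn_r μ
  rw [isInvariantMeasure_iff_comap]
  refine ⟨fun h k => ?_, fun h B hB ho => (hcomap B hB ho).2 fun k _ => h k⟩
  refine Cc.map_eq_map_of_locally (integralLinearMap μ ∘ₗ Cc.sourceSum G)
    (integralLinearMap μ ∘ₗ Cc.rangeSum G) k fun γ _ => ?_
  obtain ⟨B, ho, hγ, hB⟩ := exists_isBisection_mem_nhds γ
  exact ⟨B, ho.mem_nhds hγ, fun g hg =>
    (hcomap B hB ho).1 (h B hB ho) g ((subset_tsupport g).trans hg)⟩

lemma integral_restrictUnits_mul_comm {μ : Measure (UnitSpace G)} [IsFiniteMeasure μ] [μ.Regular]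
    (h : IsInvariantMeasure μ) (f g : Cc G) :
    ∫ x, Cc.restrictUnits G (f * g) x ∂μ = ∫ x, Cc.restrictUnits G (g * f) x ∂μ := by
  rw [Cc.restrictUnits_mul_eq_sourceSum, Cc.restrictUnits_mul_eq_rangeSum,
    (isInvariantMeasure_iff_integral μ).1 h]

end Bisection

section RegularRepresentation

section SquareSummable

variable {ι : Type*}

lemma lp_two_clm_ext [DecidableEq ι]
    {T T' : lp (fun _ : ι => ℂ) 2 →L[ℂ] lp (fun _ : ι => ℂ) 2}
    (h : ∀ i j, T (lp.single 2 i 1) j = T' (lp.single 2 i 1) j) : T = T' := by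
  refine lp.ext_continuousLinearMap ENNReal.ofNat_ne_top fun i => ?_
  ext j
  simpa using h i j

lemma star_lp_two_clm_single_apply [DecidableEq ι]
    (T : lp (fun _ : ι => ℂ) 2 →L[ℂ] lp (fun _ : ι => ℂ) 2) (i j : ι) :
    star T (lp.single 2 i 1) j = star (T (lp.single 2 j 1) i) := by
  have h := T.adjoint_inner_right (lp.single 2 j 1) (lp.single 2 i 1)
  rw [lp.inner_single_left, lp.inner_single_right] at h
  simpa [ContinuousLinearMap.star_eq_adjoint] using h

end SquareSummable

variable {G : Type u} [TopologicalSpace G] [GroupoidStructure G] [EtaleGroupoid G] [T2Space G]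
  (x : UnitSpace G) (f g : Cc G)

lemma leftRegular_single_apply [DecidableEq (SFiber (x : G))] (α γ : SFiber (x : G)) :
    leftRegular x f (lp.single 2 α 1) γ = f (mul γ.1 (inv α.1)) := by
  rw [leftRegular_apply, finsum_eq_single _ α fun β hβ => by simp [hβ]]
  simp

lemma leftRegular_add : leftRegular x (f + g) = leftRegular x f + leftRegular x g := by
  classical
  exact lp_two_clm_ext fun α γ => by simp [leftRegular_single_apply]

lemma leftRegular_smul (c : ℂ) : leftRegular x (c • f) = c • leftRegular x f := by
  classical
  exact lp_two_clm_ext fun α γ => by simp [leftRegular_single_apply]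

lemma leftRegular_mul : leftRegular x (f * g) = leftRegular x f * leftRegular x g := by
  classical
  refine lp_two_clm_ext fun α ⟨γ, hγ⟩ => ?_
  obtain rfl : s γ = x := Subtype.ext hγ
  rw [leftRegular_single_apply, Cc.coe_mul, conv_translate f g α.2.symm,
    mul_apply_eq_comp, leftRegular_apply]
  simp_rw [leftRegular_single_apply]
  rfl

lemma leftRegular_star : leftRegular x (star f) = star (leftRegular x f) := by
  classical
  refine lp_two_clm_ext fun α γ => ?_
  rw [star_lp_two_clm_single_apply, leftRegular_single_apply, leftRegular_single_apply,
    Cc.coe_star, involution, inv_mul_inv (γ.2.trans α.2.symm)]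

/-- The left regular representation as a `*`-homomorphism. -/
noncomputable def leftRegularHom :
    Cc G →⋆ₙₐ[ℂ] (lp (fun _ : SFiber (x : G) => ℂ) 2 →L[ℂ] lp (fun _ : SFiber (x : G) => ℂ) 2) where
  toFun := leftRegular x
  map_smul' c f := leftRegular_smul x f c
  map_zero' := by simpa using leftRegular_smul x 0 0
  map_add' := leftRegular_add x
  map_mul' := leftRegular_mul x
  map_star' := leftRegular_star x

variable {f}

lemma norm_apply_le_norm_leftRegular (γ : G) : ‖f γ‖ ≤ ‖leftRegular (s γ) f‖ := by
  classical
  let ξ : lp (fun _ : SFiber ((s γ : UnitSpace G) : G) => ℂ) 2 := lp.single 2 ⟨src γ, src_src γ⟩ 1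
  have hγ : leftRegular (s γ) f ξ ⟨γ, rfl⟩ = f γ := by
    rw [leftRegular_single_apply, inv_of_mem_units (src_src γ), mul_src]
  calc ‖f γ‖ ≤ ‖leftRegular (s γ) f ξ‖ := hγ ▸ lp.norm_apply_le_norm two_ne_zero _ _
    _ ≤ ‖leftRegular (s γ) f‖ * ‖ξ‖ := ContinuousLinearMap.le_opNorm _ _
    _ = ‖leftRegular (s γ) f‖ := by rw [lp.norm_single two_pos, norm_one, mul_one]

lemma norm_apply_le_reducedNorm (γ : G) : ‖f γ‖ ≤ reducedNorm f :=
  (norm_apply_le_norm_leftRegular γ).trans <|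
    le_ciSup (f := fun x => ‖leftRegular x f‖)
      ⟨iNorm f, Set.forall_mem_range.2 fun x => norm_leftRegular_le x f⟩ (s γ)

end RegularRepresentation

section CStarSeminorms

section

variable {A : Type*} [NonUnitalRing A] [StarRing A] [Module ℂ A]

/-- The submultiplicative seminorms satisfying the `C*`-identity. -/
structure IsCStarSeminorm (p : Seminorm ℂ A) : Prop where
  mul_le : ∀ a b, p (a * b) ≤ p a * p b
  star_mul_self : ∀ a, p (star a * a) = p a ^ 2

/-- The seminorm `a ↦ ‖π a‖` of a `*`-homomorphism `π` into a `C*`-algebra. -/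
noncomputable def pullbackSeminorm {B : Type*} [NonUnitalCStarAlgebra B] (π : A →⋆ₙₐ[ℂ] B) :
    Seminorm ℂ A :=
  (normSeminorm ℂ B).comp (LinearMapClass.linearMap π)

lemma isCStarSeminorm_pullbackSeminorm {B : Type*} [NonUnitalCStarAlgebra B]
    (π : A →⋆ₙₐ[ℂ] B) : IsCStarSeminorm (pullbackSeminorm π) where
  mul_le a b := (congrArg norm (map_mul π a b)).trans_le (norm_mul_le _ _)
  star_mul_self a := by
    change ‖π (star a * a)‖ = ‖π a‖ ^ 2
    rw [map_mul, map_star, CStarRing.norm_star_mul_self, sq]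

lemma isCStarSeminorm_sSup {S : Set (Seminorm ℂ A)} (hS : ∀ p ∈ S, IsCStarSeminorm p)
    (hb : BddAbove S) : IsCStarSeminorm (sSup S) := by
  have hle {p : Seminorm ℂ A} (hp : p ∈ S) (a : A) : p a ≤ sSup S a := le_csSup hb hp a
  have hsup {a : A} {c : ℝ} (hc : 0 ≤ c) (h : ∀ p ∈ S, p a ≤ c) : sSup S a ≤ c := by
    rw [Seminorm.sSup_apply hb]
    exact Real.iSup_le (fun p => h p p.2) hc
  refine ⟨fun a b => hsup (by positivity) fun p hp => ?_, fun a => le_antisymm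
    (hsup (by positivity) fun p hp => ?_) ?_⟩
  · exact ((hS p hp).mul_le a b).trans (by gcongr <;> exact hle hp _)
  · rw [(hS p hp).star_mul_self]
    gcongr
    exact hle hp a
  · refine (Real.le_sqrt (apply_nonneg _ _) (apply_nonneg _ _)).1 ?_
    exact hsup (Real.sqrt_nonneg _) fun p hp => Real.le_sqrt_of_sq_le <|
      (hS p hp).star_mul_self a ▸ hle hp _

end

variable {G : Type u} [TopologicalSpace G] [GroupoidStructure G] [EtaleGroupoid G] [T2Space G]

/-- A separating `C*`-seminorm on `C_c(G)` as a `C*`-norm. -/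
noncomputable def CStarNorm.ofIsCStarSeminorm {p : Seminorm ℂ (Cc G)} (hp : IsCStarSeminorm p)
    (hsep : ∀ f, p f = 0 → f = 0) : CStarNorm G where
  __ := p
  eq_zero_of_map_eq_zero' := hsep
  mul_le' := hp.mul_le
  star_mul_self' := hp.star_mul_self

lemma bddAbove_of_le_iNorm {S : Set (Seminorm ℂ (Cc G))} (hS : ∀ p ∈ S, ∀ f, p f ≤ iNorm f) :
    BddAbove S :=
  Seminorm.bddAbove_iff.2 ⟨iNorm, Set.forall_mem_image.2 fun p hp f => hS p hp f⟩

variable (G) in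
/-- The seminorms `f ↦ ‖π f‖` of the `*`-representations `π` of `C_c(G)` on Hilbert spaces that are
contractive for the `I`-norm; their supremum is the maximal norm. -/
def representationSeminorms : Set (Seminorm ℂ (Cc G)) :=
  {p | ∃ (H : Type u) (_ : NormedAddCommGroup H) (_ : InnerProductSpace ℂ H)
    (_ : CompleteSpace H) (π : Cc G →⋆ₙₐ[ℂ] (H →L[ℂ] H)),
    (∀ g : Cc G, ‖π g‖ ≤ iNorm g) ∧ p = pullbackSeminorm π}

lemma isCStarSeminorm_of_mem_representationSeminorms {p : Seminorm ℂ (Cc G)}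
    (hp : p ∈ representationSeminorms G) : IsCStarSeminorm p := by
  obtain ⟨H, _, _, _, π, -, rfl⟩ := hp
  exact isCStarSeminorm_pullbackSeminorm π

lemma bddAbove_representationSeminorms : BddAbove (representationSeminorms G) :=
  bddAbove_of_le_iNorm fun _ ⟨_, _, _, _, _, hπ, hp⟩ => hp ▸ hπ

lemma range_leftRegular_subset_representationSeminorms :
    (Set.range fun x : UnitSpace G => pullbackSeminorm (leftRegularHom x)) ⊆
      representationSeminorms G :=
  Set.range_subset_iff.2 fun x =>
    ⟨_, _, _, inferInstance, leftRegularHom x, norm_leftRegular_le x, rfl⟩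

lemma iSup_leftRegular_apply (f : Cc G) :
    (⨆ x : UnitSpace G, pullbackSeminorm (leftRegularHom x)) f = reducedNorm f :=
  Seminorm.iSup_apply
    (bddAbove_representationSeminorms.mono range_leftRegular_subset_representationSeminorms)

lemma sSup_representationSeminorms_apply (f : Cc G) :
    sSup (representationSeminorms G) f = maximalNorm f := by
  rw [Seminorm.sSup_apply bddAbove_representationSeminorms, maximalNorm, _root_.iSup]
  congr 1
  ext c
  constructor
  · rintro ⟨⟨_, H, _, _, _, π, hπ, rfl⟩, rfl⟩
    exact ⟨H, _, _, _, π, hπ, rfl⟩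
  · rintro ⟨H, _, _, _, π, hπ, rfl⟩
    exact ⟨⟨_, H, _, _, _, π, hπ, rfl⟩, rfl⟩

lemma reducedNorm_le_maximalNorm (f : Cc G) : reducedNorm f ≤ maximalNorm f := by
  rw [← sSup_representationSeminorms_apply]
  exact Real.iSup_le (fun x => le_csSup bddAbove_representationSeminorms
    (range_leftRegular_subset_representationSeminorms ⟨x, rfl⟩) f) (apply_nonneg _ f)

lemma eq_zero_of_reducedNorm_eq_zero {f : Cc G} (h : reducedNorm f = 0) : f = 0 :=
  Cc.coe_inj (funext fun γ => norm_le_zero_iff.1 ((norm_apply_le_reducedNorm γ).trans h.le))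

variable (G) in
/-- The reduced norm as a `C*`-norm. -/
noncomputable def reducedCStarNorm : CStarNorm G :=
  .ofIsCStarSeminorm (p := ⨆ x : UnitSpace G, pullbackSeminorm (leftRegularHom x))
    (isCStarSeminorm_sSup (Set.forall_mem_range.2 fun _ => isCStarSeminorm_pullbackSeminorm _)
      (bddAbove_representationSeminorms.mono range_leftRegular_subset_representationSeminorms))
    fun f hf => eq_zero_of_reducedNorm_eq_zero ((iSup_leftRegular_apply f).symm.trans hf)

lemma reducedCStarNorm_apply (f : Cc G) : reducedCStarNorm G f = reducedNorm f :=
  iSup_leftRegular_apply f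

variable (G) in
/-- The maximal norm as a `C*`-norm. -/
noncomputable def maximalCStarNorm : CStarNorm G :=
  .ofIsCStarSeminorm (p := sSup (representationSeminorms G))
    (isCStarSeminorm_sSup (fun _ => isCStarSeminorm_of_mem_representationSeminorms)
      bddAbove_representationSeminorms)
    fun f hf => eq_zero_of_reducedNorm_eq_zero <|
      ((reducedNorm_le_maximalNorm f).trans_eq
        ((sSup_representationSeminorms_apply f).symm.trans hf)).antisymm
        (Real.iSup_nonneg fun _ => norm_nonneg _)

lemma maximalCStarNorm_apply (f : Cc G) : maximalCStarNorm G f = maximalNorm f :=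
  sSup_representationSeminorms_apply f

lemma dominatesReduced_reducedCStarNorm : (reducedCStarNorm G).DominatesReduced :=
  fun f => (reducedCStarNorm_apply f).ge

lemma dominatesReduced_maximalCStarNorm : (maximalCStarNorm G).DominatesReduced :=
  fun f => (reducedNorm_le_maximalNorm f).trans_eq (maximalCStarNorm_apply f).symm

end CStarSeminorms

section PositiveFunctionals

/-- A linear functional that is nonnegative on the squares `star a * a`, as a positive linear
map. -/
def positiveOfStarMulSelf {A : Type*} [NonUnitalRing A] [Module ℂ A] [StarRing A] [PartialOrder A]
    [StarOrderedRing A] (φ : A →ₗ[ℂ] ℂ) (hφ : ∀ a, 0 ≤ φ (star a * a)) : A →ₚ[ℂ] ℂ :=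
  .mk₀ φ fun a ha => by
    refine AddSubmonoid.closure_induction ?_ ?_ ?_ (StarOrderedRing.nonneg_iff.1 ha)
    · rintro _ ⟨b, rfl⟩
      exact hφ b
    · exact (map_zero φ).ge
    · intro b c _ _ hb hc
      rw [map_add]
      exact add_nonneg hb hc

lemma norm_map_star_mul_sq_le {A : Type*} [CStarAlgebra A] {φ : A →ₗ[ℂ] ℂ}
    (hφ : ∀ a, 0 ≤ φ (star a * a)) (a b : A) :
    ‖φ (star a * b)‖ ^ 2 ≤ (φ (star a * a)).re * (φ (star b * b)).re := by
  let := CStarAlgebra.spectralOrder A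
  have := CStarAlgebra.spectralOrderedRing A
  let ψ := positiveOfStarMulSelf φ hφ
  have hnorm (c : A) : (φ (star c * c)).re = ‖ψ.toPreGNS c‖ ^ 2 := by
    have h : (‖ψ.toPreGNS c‖ : ℂ) ^ 2 = φ (star c * c) := ψ.preGNS_norm_sq _
    rw [← h, ← Complex.ofReal_pow, Complex.ofReal_re]
  have hinner : inner ℂ (ψ.toPreGNS a) (ψ.toPreGNS b) = φ (star a * b) := ψ.preGNS_inner_def _ _
  rw [hnorm, hnorm, ← mul_pow, ← hinner]
  gcongr
  exact norm_inner_le_norm _ _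

end PositiveFunctionals

section TracialStates

variable {A : Type*} [CStarAlgebra A]

variable (A) in
lemma convex_tracialStates : Convex ℝ (tracialStates A) := by
  intro σ hσ τ hτ a b ha hb hab
  have h (x : A) : (a • σ + b • τ) x = (a : ℂ) * σ x + (b : ℂ) * τ x := rfl
  refine ⟨fun x => ?_, ?_, fun x y => ?_⟩
  · rw [h]
    exact add_nonneg (mul_nonneg (by exact_mod_cast ha) (hσ.1 x))
      (mul_nonneg (by exact_mod_cast hb) (hτ.1 x))
  · rw [h, hσ.2.1, hτ.2.1, mul_one, mul_one]
    exact_mod_cast hab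
  · rw [h, h, hσ.2.2, hτ.2.2]

lemma mem_tracialStates_of_denseRange {B : Type*} [Semiring B] [Algebra ℂ B] [Star B]
    {j : B →⋆ₐ[ℂ] A} (hj : DenseRange j) {τ : WeakDual ℂ A}
    (hpos : ∀ b, 0 ≤ τ (j (star b * b))) (hone : τ (j 1) = 1)
    (hcomm : ∀ a b, τ (j (a * b)) = τ (j (b * a))) : τ ∈ tracialStates A := by
  have hc := map_continuous τ
  refine ⟨fun a => ?_, by rwa [map_one] at hone, fun a b => ?_⟩
  · refine hj.induction_on a (isClosed_le continuous_const
      (hc.comp (continuous_star.mul continuous_id))) fun b => ?_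
    rw [← map_star, ← map_mul]
    exact hpos b
  · refine hj.induction_on₂ (p := fun a b => τ (a * b) = τ (b * a))
      (isClosed_eq (hc.comp continuous_mul) (hc.comp (continuous_snd.mul continuous_fst)))
      (fun a b => ?_) a b
    rw [← map_mul, ← map_mul]
    exact hcomm a b

end TracialStates

section TraceOfMeasure

open MeasureTheory Cc

variable {G : Type u} [TopologicalSpace G] [GroupoidStructure G] [EtaleGroupoid G] [T2Space G]

lemma norm_integral_restrictUnits_le [MeasurableSpace G] {ν : CStarNorm G}
    (hν : ν.DominatesReduced) (μ : Measure (UnitSpace G)) [IsProbabilityMeasure μ] (f : Cc G) :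
    ‖∫ x, restrictUnits G f x ∂μ‖ ≤ ν f := by
  have h := norm_integral_le_of_norm_le_const (μ := μ) (f := restrictUnits G f) (C := ν f)
    (.of_forall fun x => (norm_apply_le_reducedNorm x.1).trans (hν f))
  rwa [probReal_univ, mul_one] at h

variable [CompactSpace (UnitSpace G)]

section Embedding

variable (ν : CStarNorm G)

/-- The embedding of `C_c(G)` into `C*_ν(G)` as a `*`-homomorphism. -/
noncomputable def CStarNorm.embed : Cc G →⋆ₐ[ℂ] ν.Completion where
  toFun f := UniformSpace.Completion.coe' (α := ν.Alg) f
  map_one' := UniformSpace.Completion.coe_one ν.Alg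
  map_mul' f g := UniformSpace.Completion.coe_mul (α := ν.Alg) f g
  map_zero' := UniformSpace.Completion.coe_zero (α := ν.Alg)
  map_add' f g := UniformSpace.Completion.coe_add (α := ν.Alg) f g
  commutes' _ := rfl
  map_star' f := completion_coe_star (A := ν.Alg) f

lemma CStarNorm.norm_embed (f : Cc G) : ‖ν.embed f‖ = ν f :=
  UniformSpace.Completion.norm_coe (E := ν.Alg) f

lemma CStarNorm.embed_inclusion (f : C(UnitSpace G, ℂ)) :
    ν.embed (inclusion f) = ν.unitFunction f := rfl

lemma CStarNorm.denseRange_embed : DenseRange ν.embed :=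
  UniformSpace.Completion.denseRange_coe (α := ν.Alg)

end Embedding

variable [MeasurableSpace G] [BorelSpace G] {ν : CStarNorm G} (hν : ν.DominatesReduced)
  (μ : Measure (UnitSpace G)) [IsProbabilityMeasure μ]

/-- The functional `f ↦ ∫ f|_{G⁰} dμ` on `C_c(G)` with the norm `ν`. -/
noncomputable def traceOnAlg : ν.Alg →L[ℂ] ℂ :=
  LinearMap.mkContinuous (integralLinearMap μ ∘ₗ restrictUnits G) 1 fun f =>
    (norm_integral_restrictUnits_le hν μ f).trans_eq (one_mul _).symm

/-- The continuous extension of `f ↦ ∫ f|_{G⁰} dμ` to `C*_ν(G)`. -/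
noncomputable def traceOfMeasure : WeakDual ℂ ν.Completion :=
  StrongDual.toWeakDual
    ((traceOnAlg hν μ).extend (UniformSpace.Completion.toComplL (𝕜 := ℂ) (E := ν.Alg)))

lemma traceOfMeasure_embed (f : Cc G) :
    traceOfMeasure hν μ (ν.embed f) = ∫ x, restrictUnits G f x ∂μ :=
  ContinuousLinearMap.extend_eq (traceOnAlg hν μ)
    (UniformSpace.Completion.denseRange_coe (α := ν.Alg))
    (UniformSpace.Completion.isUniformInducing_coe ν.Alg) f

lemma traceOfMeasure_unitFunction (f : C(UnitSpace G, ℂ)) :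
    traceOfMeasure hν μ (ν.unitFunction f) = ∫ x, f x ∂μ := by
  rw [← ν.embed_inclusion, traceOfMeasure_embed, restrictUnits_inclusion]

lemma norm_traceOfMeasure_le (a : ν.Completion) : ‖traceOfMeasure hν μ a‖ ≤ ‖a‖ := by
  refine ν.denseRange_embed.induction_on a ?_ fun f => ?_
  · exact isClosed_le (map_continuous (traceOfMeasure hν μ)).norm continuous_norm
  · rw [traceOfMeasure_embed, ν.norm_embed]
    exact norm_integral_restrictUnits_le hν μ f

variable [LocallyCompactSpace G]

lemma traceOfMeasure_mem_tracialStates [μ.Regular] (hμ : IsInvariantMeasure μ) :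
    traceOfMeasure hν μ ∈ tracialStates ν.Completion := by
  refine mem_tracialStates_of_denseRange ν.denseRange_embed (fun f => ?_) ?_ fun f g => ?_
  · rw [traceOfMeasure_embed]
    exact integral_nonneg (restrictUnits_star_mul_self_nonneg f)
  · refine (traceOfMeasure_unitFunction hν μ 1).trans ?_
    simp only [ContinuousMap.one_apply, integral_const, probReal_univ, one_smul]
  · rw [traceOfMeasure_embed, traceOfMeasure_embed, integral_restrictUnits_mul_comm hμ]

end TraceOfMeasure

section Cutoff

lemma exists_continuousMap_eqOn_zero_eqOn_one {X : Type*} [TopologicalSpace X] [NormalSpace X]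
    {F K : Set X} (hF : IsClosed F) (hK : IsClosed K) (hd : Disjoint F K) :
    ∃ e : C(X, ℂ), Set.EqOn e 0 F ∧ Set.EqOn e 1 K ∧ ∀ x, ‖e x‖ ≤ 1 := by
  obtain ⟨e, he0, he1, he⟩ := exists_continuous_zero_one_of_isClosed hF hK hd
  refine ⟨⟨fun x => (e x : ℂ), by fun_prop⟩, fun x hx => ?_, fun x hx => ?_, fun x => ?_⟩
  · exact Complex.ofReal_eq_zero.2 (he0 hx)
  · exact Complex.ofReal_eq_one.2 (he1 hx)
  · rw [ContinuousMap.coe_mk, Complex.norm_of_nonneg (he x).1]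
    exact (he x).2

lemma Cc.exists_support_subset_eqOn_one {E : Type u} [TopologicalSpace E] [T2Space E]
    [LocallyCompactSpace E] {K B : Set E} (hK : IsCompact K) (hB : IsOpen B) (hKB : K ⊆ B) :
    ∃ b : Cc E, Function.support b ⊆ B ∧ Set.EqOn b 1 K := by
  obtain ⟨φ, hφ1, hφ0, hφc, -⟩ := exists_continuous_one_zero_of_isCompact hK hB.isClosed_compl
    (Set.disjoint_compl_right_iff_subset.2 hKB)
  refine ⟨.of (fun x => (φ x : ℂ)) (by fun_prop) (hφc.comp_left Complex.ofReal_zero),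
    fun x hx => ?_, fun x hx => ?_⟩
  · by_contra hxB
    exact hx (Complex.ofReal_eq_zero.2 (hφ0 hxB))
  · exact Complex.ofReal_eq_one.2 (hφ1 hx)

end Cutoff

lemma exists_isBisection_disjoint_units {G : Type u} [TopologicalSpace G] [GroupoidStructure G]
    [EtaleGroupoid G] [T2Space G] [LocallyCompactSpace G] {γ : G} (hγ : γ ∉ units G) :
    ∃ B : Set G, IsOpen B ∧ γ ∈ B ∧ IsBisection B ∧ IsCompact (closure B) ∧
      Disjoint B (units G) := by
  obtain ⟨B, ho, hγB, hB⟩ := exists_isBisection_mem_nhds γ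
  obtain ⟨K, hK, hγK⟩ := exists_compact_mem_nhds γ
  have ho' : IsOpen (B ∩ (units G)ᶜ ∩ interior K) :=
    (ho.inter isClosed_units.isOpen_compl).inter isOpen_interior
  refine ⟨_, ho', ⟨⟨hγB, hγ⟩, mem_interior_iff_mem_nhds.2 hγK⟩,
    hB.mono ho' fun x hx => hx.1.1, ?_, Set.disjoint_left.2 fun x hx => hx.1.2⟩
  exact hK.of_isClosed_subset isClosed_closure
    (closure_minimal (Set.inter_subset_right.trans interior_subset) hK.isClosed)

section MeasureOfTrace

open MeasureTheory Cc

variable {G : Type u} [TopologicalSpace G] [GroupoidStructure G] [EtaleGroupoid G] [T2Space G]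
  [CompactSpace (UnitSpace G)]

section Bisection

variable {B : Set G} {b g : Cc G} (hb : Function.support b ⊆ B) (hg : Function.support g ⊆ B)
  (hbg : Set.EqOn b 1 (Function.support g))

include hb hg hbg

lemma star_mul_eq_inclusion_sourceSum (hB : Set.InjOn (r : G → UnitSpace G) B) :
    star b * g = inclusion (sourceSum G g) := by
  rw [eq_inclusion_restrictUnits fun γ hγ => star_mul_apply_eq_zero hB hb hg hγ,
    restrictUnits_mul_eq_sourceSum, invCompMul_star_eq_right hbg]

lemma mul_star_eq_inclusion_rangeSum (hB : Set.InjOn (s : G → UnitSpace G) B) :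
    g * star b = inclusion (rangeSum G g) := by
  rw [eq_inclusion_restrictUnits fun γ hγ => mul_star_apply_eq_zero hB hg hb hγ,
    restrictUnits_mul_eq_rangeSum, invCompMul_star_eq_right hbg]

end Bisection

section TracialMaps

variable [LocallyCompactSpace G] {M : Type*} [AddCommMonoid M] {L : Cc G →+ M}
  (hL : ∀ f g, L (f * g) = L (g * f))

include hL

-- An Urysohn function `e` with `e ∘ r = 1` and `e ∘ s = 0` near `γ` turns `g` into `e * g` and
-- annihilates `g * e`.
lemma map_eq_zero_of_s_ne_r {f : Cc G} (hf : ∀ γ ∈ tsupport f, s γ ≠ r γ) : L f = 0 := by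
  refine map_eq_map_of_locally L (0 : Cc G →+ M) f fun γ hγ => ?_
  obtain ⟨V, hsV, hVo, W, hrW, hWo, hd⟩ := exists_open_nhds_disjoint_closure (hf γ hγ)
  obtain ⟨e, he0, he1, -⟩ :=
    exists_continuousMap_eqOn_zero_eqOn_one isClosed_closure isClosed_closure hd
  refine ⟨s ⁻¹' V ∩ r ⁻¹' W, Filter.inter_mem ((hVo.preimage continuous_s).mem_nhds hsV)
    ((hWo.preimage continuous_r).mem_nhds hrW), fun g hg => ?_⟩
  have hsupp {γ : G} (hγ : g γ ≠ 0) : γ ∈ s ⁻¹' V ∩ r ⁻¹' W := hg (subset_tsupport g hγ)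
  have hleft : inclusion e * g = g := coe_inj (funext fun γ => by
    rw [inclusion_mul_apply]
    by_cases hγ : g γ = 0
    · rw [hγ, mul_zero]
    · rw [he1 (subset_closure (hsupp hγ).2), Pi.one_apply, one_mul])
  have hright : g * inclusion e = 0 := coe_inj (funext fun γ => by
    rw [mul_inclusion_apply]
    by_cases hγ : g γ = 0
    · rw [hγ, zero_mul, coe_zero, Pi.zero_apply]
    · rw [he0 (subset_closure (hsupp hγ).1), Pi.zero_apply, mul_zero, coe_zero, Pi.zero_apply])
  rw [← hleft, hL, hright, map_zero, AddMonoidHom.zero_apply]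

lemma map_mul_inclusion_eq_zero {f : Cc G} {k : C(UnitSpace G, ℂ)}
    (hk : ∀ γ ∈ tsupport f, s γ = r γ → s γ ∉ tsupport k) : L (f * inclusion k) = 0 := by
  have hsupp : Function.support (f * inclusion k : Cc G) ⊆ tsupport f ∩ s ⁻¹' tsupport k := by
    intro γ hγ
    rw [Function.mem_support, mul_inclusion_apply] at hγ
    exact ⟨subset_tsupport f (left_ne_zero_of_mul hγ), subset_tsupport k (right_ne_zero_of_mul hγ)⟩
  refine map_eq_zero_of_s_ne_r hL fun γ hγ hsr => ?_
  have hγ' := closure_minimal hsupp ((isClosed_tsupport f).inter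
    ((isClosed_tsupport k).preimage continuous_s)) hγ
  exact hk γ hγ'.1 hsr hγ'.2

end TracialMaps

/-- The embedding of the functions on the unit space into `C*_ν(G)` as a `*`-homomorphism. -/
noncomputable def CStarNorm.unitHom (ν : CStarNorm G) : C(UnitSpace G, ℂ) →⋆ₐ[ℂ] ν.Completion :=
  ν.embed.comp (inclusionHom G)

variable {ν : CStarNorm G} {τ : WeakDual ℂ ν.Completion}

lemma map_embed_mul_comm (hτ : τ ∈ tracialStates ν.Completion) (f g : Cc G) :
    τ (ν.embed (f * g)) = τ (ν.embed (g * f)) := by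
  rw [map_mul ν.embed, map_mul ν.embed, hτ.2.2]

variable [MeasurableSpace G] [BorelSpace G]

lemma exists_isAssociatedMeasure (hτ : τ ∈ tracialStates ν.Completion) :
    ∃ μ : FiniteMeasure (UnitSpace G), IsAssociatedMeasure τ μ := by
  let φ : C(UnitSpace G, ℂ) →ₗ[ℂ] ℂ := (τ : ν.Completion →ₗ[ℂ] ℂ) ∘ₗ ν.unitHom.toLinearMap
  have hφ (f : C(UnitSpace G, ℂ)) : 0 ≤ φ (star f * f) := by
    change 0 ≤ τ (ν.unitHom (star f * f))
    rw [map_mul, map_star]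
    exact hτ.1 _
  obtain ⟨m, hfin, hreg, hm⟩ := exists_regular_integral_eq (positiveOfStarMulSelf φ hφ)
  have huniv : (m.real Set.univ : ℂ) = 1 := by
    have h : φ 1 = ∫ x, (1 : C(UnitSpace G, ℂ)) x ∂m := hm 1
    have hφ1 : φ 1 = 1 := (congrArg τ (map_one ν.unitHom)).trans hτ.2.1
    simpa only [hφ1, ContinuousMap.one_apply, integral_const, Complex.real_smul, mul_one]
      using h.symm
  have hprob : IsProbabilityMeasure m :=
    ⟨(ENNReal.toReal_eq_one_iff _).1 (Complex.ofReal_eq_one.1 huniv)⟩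
  exact ⟨⟨m, hfin⟩, hprob, hreg, hm⟩

variable {μ : FiniteMeasure (UnitSpace G)}

lemma IsAssociatedMeasure.unique {μ' : FiniteMeasure (UnitSpace G)}
    (h : IsAssociatedMeasure τ μ) (h' : IsAssociatedMeasure τ μ') : μ = μ' := by
  have := h.2.1
  have := h'.2.1
  have hμ : (μ : Measure (UnitSpace G)) = μ' :=
    measure_ext_of_integral_continuousMap fun f => (h.2.2 f).symm.trans (h'.2.2 f)
  exact Subtype.ext hμ

lemma IsAssociatedMeasure.re_map_star_mul_self_le (h : IsAssociatedMeasure τ μ)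
    {e : C(UnitSpace G, ℂ)} {U : Set (UnitSpace G)} (hU : IsOpen U) (he : ∀ x, ‖e x‖ ≤ 1)
    (heU : Set.EqOn e 0 Uᶜ) :
    (τ (star (ν.unitFunction e) * ν.unitFunction e)).re ≤
      (μ : Measure (UnitSpace G)).real U := by
  have hmul : star (ν.unitFunction e) * ν.unitFunction e = ν.unitFunction (star e * e) := by
    change star (ν.unitHom e) * ν.unitHom e = ν.unitHom (star e * e)
    rw [map_mul, map_star]
  rw [hmul, h.2.2, ← integral_indicator_one hU.measurableSet]
  refine (Complex.re_le_norm _).trans (norm_integral_le_of_norm_le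
    ((integrable_const 1).indicator hU.measurableSet) (.of_forall fun x => ?_))
  rw [ContinuousMap.mul_apply, ContinuousMap.star_apply, norm_mul, norm_star]
  by_cases hx : x ∈ U
  · rw [Set.indicator_of_mem hx]
    exact mul_le_one₀ (he x) (norm_nonneg _) (he x)
  · rw [Set.indicator_of_notMem hx, heU hx, Pi.zero_apply, norm_zero, mul_zero]

variable [LocallyCompactSpace G]

lemma IsAssociatedMeasure.isInvariantMeasure (hτ : τ ∈ tracialStates ν.Completion)
    (h : IsAssociatedMeasure τ μ) : IsInvariantMeasure (μ : Measure (UnitSpace G)) := by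
  have := h.2.1
  let I : C(UnitSpace G, ℂ) →ₗ[ℂ] ℂ := integralLinearMap (μ : Measure (UnitSpace G))
  refine (isInvariantMeasure_iff_integral _).2 fun k =>
    map_eq_map_of_locally (I ∘ₗ sourceSum G) (I ∘ₗ rangeSum G) k fun γ _ => ?_
  obtain ⟨B, ho, hγ, hB⟩ := exists_isBisection_mem_nhds γ
  refine ⟨B, ho.mem_nhds hγ, fun g hg => ?_⟩
  obtain ⟨b, hb, hbg⟩ := exists_support_subset_eqOn_one g.hasCompactSupport ho hg
  have hg' := (subset_tsupport g).trans hg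
  have hbg' := hbg.mono (subset_tsupport g)
  have hcomm := map_embed_mul_comm hτ (star b) g
  rwa [star_mul_eq_inclusion_sourceSum hb hg' hbg' hB.injOn_r,
    mul_star_eq_inclusion_rangeSum hb hg' hbg' hB.injOn_s, ν.embed_inclusion, ν.embed_inclusion,
    h.2.2, h.2.2] at hcomm

lemma IsAssociatedMeasure.norm_map_embed_sq_le (hτ : τ ∈ tracialStates ν.Completion)
    (h : IsAssociatedMeasure τ μ) {f : Cc G} {U : Set (UnitSpace G)} (hU : IsOpen U)
    (hfU : ∀ γ ∈ tsupport f, s γ = r γ → s γ ∈ U) :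
    ‖τ (ν.embed f)‖ ^ 2 ≤
      (τ (ν.embed (f * star f))).re * (μ : Measure (UnitSpace G)).real U := by
  have hF : IsCompact (s '' (tsupport f ∩ {γ | s γ = r γ}) : Set (UnitSpace G)) :=
    (f.hasCompactSupport.inter_right (isClosed_eq continuous_s continuous_r)).image continuous_s
  obtain ⟨V, hVo, hFV, hVU⟩ := normal_exists_closure_subset hF.isClosed hU
    (Set.image_subset_iff.2 fun γ hγ => hfU γ hγ.1 hγ.2)
  obtain ⟨e, he0, he1, he⟩ := exists_continuousMap_eqOn_zero_eqOn_one hU.isClosed_compl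
    isClosed_closure (Set.disjoint_compl_left_iff_subset.2 hVU)
  have hsupp : tsupport ⇑(1 - e) ⊆ Vᶜ := closure_minimal
    (fun x hx hxV => hx (sub_eq_zero.2 (he1 (subset_closure hxV)).symm)) hVo.isClosed_compl
  have hzero : τ (ν.embed (f * inclusion (1 - e))) = 0 :=
    map_mul_inclusion_eq_zero
      (L := (τ : ν.Completion →+ ℂ).comp (ν.embed : Cc G →+ ν.Completion))
      (map_embed_mul_comm hτ) fun γ hγ hsr hk => hsupp hk (hFV ⟨γ, ⟨hγ, hsr⟩, rfl⟩)
  have hcut : τ (ν.embed f) = τ (star (ν.embed (star f)) * ν.unitFunction e) := by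
    have hsum : f = f * inclusion e + f * inclusion (1 - e) := by
      rw [← mul_add, ← inclusion_add, add_sub_cancel]
      exact (mul_one f).symm
    rw [← map_star, star_star, ← ν.embed_inclusion, ← map_mul]
    conv_lhs => rw [hsum, map_add, map_add, hzero, add_zero]
  have hstar : star (ν.embed (star f)) * ν.embed (star f) = ν.embed (f * star f) := by
    rw [← map_star, star_star, ← map_mul]
  rw [hcut, ← hstar]
  exact (norm_map_star_mul_sq_le (φ := (τ : ν.Completion →ₗ[ℂ] ℂ)) hτ.1 _ _).trans
    (mul_le_mul_of_nonneg_left (h.re_map_star_mul_self_le hU he he0)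
      (Complex.le_def.1 (hτ.1 _)).1)

lemma IsAssociatedMeasure.map_embed_eq_zero (hτ : τ ∈ tracialStates ν.Completion)
    (h : IsAssociatedMeasure τ μ) {f : Cc G}
    (hf : (μ : Measure (UnitSpace G)) (s '' (tsupport f ∩ {γ | s γ = r γ})) = 0) :
    τ (ν.embed f) = 0 := by
  have := h.2.1
  set C : ℝ := (τ (ν.embed (f * star f))).re
  have hle : ∀ ε > 0, ‖τ (ν.embed f)‖ ^ 2 ≤ C * ε := by
    intro ε hε
    obtain ⟨U, hfU, hUo, hUε⟩ := Set.exists_isOpen_lt_of_lt _ (ENNReal.ofReal ε)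
      (hf.trans_lt (ENNReal.ofReal_pos.2 hε))
    have hC : 0 ≤ C := by
      have := hτ.1 (star (ν.embed f))
      rw [star_star, ← map_star, ← map_mul] at this
      exact (Complex.le_def.1 this).1
    exact (h.norm_map_embed_sq_le hτ hUo fun γ hγ hsr => hfU ⟨γ, ⟨hγ, hsr⟩, rfl⟩).trans
      (mul_le_mul_of_nonneg_left (ENNReal.toReal_le_of_le_ofReal hε.le hUε.le) hC)
  have hlim : Filter.Tendsto (fun ε => C * ε) (𝓝[>] 0) (𝓝 0) :=
    ((continuous_const.mul continuous_id).tendsto' 0 0 (mul_zero C)).mono_left nhdsWithin_le_nhds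
  have hsq : ‖τ (ν.embed f)‖ ^ 2 ≤ 0 := ge_of_tendsto hlim (eventually_mem_nhdsWithin.mono hle)
  exact norm_eq_zero.1 (pow_eq_zero_iff two_ne_zero |>.1 (hsq.antisymm (sq_nonneg _)))

lemma IsAssociatedMeasure.map_embed_eq_zero_of_fixedPoints
    (hτ : τ ∈ tracialStates ν.Completion) (h : IsAssociatedMeasure τ μ) {B : Set G}
    (hB : IsBisection B) (hfix : (μ : Measure (UnitSpace G)) (fixedPoints hB) = 0) {f : Cc G}
    (hf : tsupport f ⊆ B) : τ (ν.embed f) = 0 := by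
  refine h.map_embed_eq_zero hτ (measure_mono_null ?_ hfix)
  rintro _ ⟨γ, ⟨hγ, hsr⟩, rfl⟩
  exact ⟨⟨γ, hf hγ, rfl⟩, (bisectionHomeo_apply hB (hf hγ)).trans (Eq.symm hsr)⟩

lemma IsAssociatedMeasure.map_embed (hτ : τ ∈ tracialStates ν.Completion)
    (h : IsAssociatedMeasure τ μ) (hfree : EssentiallyFreeFor (μ : Measure (UnitSpace G)))
    (f : Cc G) : τ (ν.embed f) = ∫ x, restrictUnits G f x ∂(μ : Measure (UnitSpace G)) := by
  refine map_eq_map_of_locally ((τ : ν.Completion →ₗ[ℂ] ℂ) ∘ₗ ν.embed.toLinearMap)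
    (integralLinearMap (μ : Measure (UnitSpace G)) ∘ₗ restrictUnits G) f fun γ _ => ?_
  by_cases hγ : γ ∈ units G
  · refine ⟨units G, isOpen_units.mem_nhds hγ, fun g hg => ?_⟩
    have hg' : g = inclusion (restrictUnits G g) := eq_inclusion_restrictUnits fun γ hγ =>
      image_eq_zero_of_notMem_tsupport (mt (@hg γ) hγ)
    exact (congrArg (fun k => τ (ν.embed k)) hg').trans (h.2.2 (restrictUnits G g))
  · obtain ⟨B, ho, hγB, hB, hcpt, hd⟩ := exists_isBisection_disjoint_units hγ
    refine ⟨B, ho.mem_nhds hγB, fun g hg => ?_⟩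
    have hg' : restrictUnits G g = 0 := ContinuousMap.ext fun x =>
      image_eq_zero_of_notMem_tsupport (f := g) fun hx => Set.disjoint_left.1 hd (hg hx) x.2
    refine (h.map_embed_eq_zero_of_fixedPoints hτ hB (hfree B hB ho hcpt hd) hg).trans ?_
    rw [LinearMap.comp_apply, hg', map_zero]

end MeasureOfTrace

lemma coe_mem_extremePoints_iff_of_equiv {𝕜 𝕜' E E' : Type*} [Semiring 𝕜] [PartialOrder 𝕜]
    [AddCommMonoid E] [SMul 𝕜 E] [Semiring 𝕜'] [PartialOrder 𝕜'] [AddCommMonoid E'] [SMul 𝕜' E']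
    {s : Set E} {t : Set E'} (e : s ≃ t)
    (he : ∀ x y z : s, (e z : E') ∈ openSegment 𝕜' (e x : E') (e y) ↔ (z : E) ∈ openSegment 𝕜 ↑x ↑y)
    (z : s) : (z : E) ∈ s.extremePoints 𝕜 ↔ (e z : E') ∈ t.extremePoints 𝕜' := by
  rw [mem_extremePoints_iff_left, mem_extremePoints_iff_left]
  refine and_congr (iff_of_true z.2 (e z).2)
    ⟨fun h x hx y hy hz => ?_, fun h x hx y hy hz => ?_⟩
  · have hx' : (e (e.symm ⟨x, hx⟩) : E') = x :=
      congrArg Subtype.val (e.apply_symm_apply _)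
    have hy' : (e (e.symm ⟨y, hy⟩) : E') = y :=
      congrArg Subtype.val (e.apply_symm_apply _)
    rw [← hx', ← hy', he] at hz
    have hxz := Subtype.ext (h _ (e.symm _).2 _ (e.symm _).2 hz)
    rw [← hx', hxz]
  · have hxz := h _ (e ⟨x, hx⟩).2 _ (e ⟨y, hy⟩).2 ((he _ _ _).2 hz)
    exact congrArg Subtype.val (e.injective (Subtype.ext hxz))

section Homeomorphism

open MeasureTheory Cc

section Convexity

variable {X : Type*} [TopologicalSpace X] [CompactSpace X] [MeasurableSpace X] [BorelSpace X]

lemma integral_smul_add_smul (μ μ' : FiniteMeasure X) (a b : ℝ≥0) (f : C(X, ℂ)) :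
    ∫ x, f x ∂((a • μ + b • μ' : FiniteMeasure X) : Measure X) =
      (a : ℂ) * ∫ x, f x ∂(μ : Measure X) + (b : ℂ) * ∫ x, f x ∂(μ' : Measure X) := by
  rw [FiniteMeasure.toMeasure_add, FiniteMeasure.toMeasure_smul, FiniteMeasure.toMeasure_smul,
    integral_add_measure (integrable_continuousMap (a • (μ : Measure X)) f)
      (integrable_continuousMap (b • (μ' : Measure X)) f),
    integral_smul_nnreal_measure, integral_smul_nnreal_measure]
  rfl

end Convexity

variable {G : Type u} [TopologicalSpace G] [GroupoidStructure G] [CompactSpace (UnitSpace G)]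
  [MeasurableSpace G] [BorelSpace G] [EtaleGroupoid G] [T2Space G] [LocallyCompactSpace G]

variable (G) in
lemma convex_invariantMeasures : Convex ℝ≥0 (invariantMeasures G) := by
  rintro μ ⟨hprob, hreg, hinv⟩ μ' ⟨hprob', hreg', hinv'⟩ a b - - hab
  have hcoe : ((a • μ + b • μ' : FiniteMeasure (UnitSpace G)) : Measure (UnitSpace G)) =
      a • (μ : Measure (UnitSpace G)) + b • (μ' : Measure (UnitSpace G)) := by
    rw [FiniteMeasure.toMeasure_add, FiniteMeasure.toMeasure_smul, FiniteMeasure.toMeasure_smul]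
  have hreg'' : ((a • μ + b • μ' : FiniteMeasure (UnitSpace G)) :
      Measure (UnitSpace G)).Regular := by
    rw [hcoe]
    infer_instance
  refine ⟨⟨?_⟩, hreg'', (isInvariantMeasure_iff_integral _).2 fun k => ?_⟩
  · rw [hcoe, Measure.add_apply, Measure.smul_apply, Measure.smul_apply, measure_univ,
      measure_univ, ENNReal.smul_def, ENNReal.smul_def, smul_eq_mul, smul_eq_mul, mul_one, mul_one]
    exact_mod_cast hab
  · rw [integral_smul_add_smul, integral_smul_add_smul, (isInvariantMeasure_iff_integral _).1 hinv,
      (isInvariantMeasure_iff_integral _).1 hinv']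

variable {ν : CStarNorm G}

/-- The invariant measure `μ_τ` associated with a tracial state `τ`. -/
noncomputable def associatedMeasure (τ : tracialStates ν.Completion) : invariantMeasures G :=
  have h := (exists_isAssociatedMeasure τ.2).choose_spec
  ⟨(exists_isAssociatedMeasure τ.2).choose, h.1, h.2.1, h.isInvariantMeasure τ.2⟩

lemma isAssociatedMeasure_associatedMeasure (τ : tracialStates ν.Completion) :
    IsAssociatedMeasure τ.1 (associatedMeasure τ).1 :=
  (exists_isAssociatedMeasure τ.2).choose_spec

lemma isAssociatedMeasure_iff {τ : tracialStates ν.Completion} {μ : FiniteMeasure (UnitSpace G)} :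
    IsAssociatedMeasure τ.1 μ ↔ μ = (associatedMeasure τ).1 :=
  ⟨fun h => h.unique (isAssociatedMeasure_associatedMeasure τ), fun h =>
    h ▸ isAssociatedMeasure_associatedMeasure τ⟩

lemma continuous_associatedMeasure :
    Continuous (associatedMeasure : tracialStates ν.Completion → invariantMeasures G) := by
  refine continuous_induced_rng.2 (continuous_iff_continuousAt.2 fun τ =>
    (FiniteMeasure.tendsto_iff_forall_integral_rclike_tendsto ℂ).2 fun f => ?_)
  have h (σ : tracialStates ν.Completion) :
      ∫ x, f x ∂((associatedMeasure σ).1 : Measure (UnitSpace G)) =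
        σ.1 (ν.unitFunction f.toContinuousMap) :=
    ((isAssociatedMeasure_associatedMeasure σ).2.2 f.toContinuousMap).symm
  simp_rw [Function.comp_apply, h]
  exact ((WeakDual.eval_continuous _).comp continuous_subtype_val).tendsto τ

lemma associatedMeasure_affine (τ₁ τ₂ τ : tracialStates ν.Completion) (a b : ℝ≥0)
    (hab : a + b = 1) (h : τ.1 = (a : ℝ) • τ₁.1 + (b : ℝ) • τ₂.1) :
    (associatedMeasure τ).1 = a • (associatedMeasure τ₁).1 + b • (associatedMeasure τ₂).1 := by
  have hm := convex_invariantMeasures G (associatedMeasure τ₁).2 (associatedMeasure τ₂).2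
    zero_le zero_le hab
  refine (isAssociatedMeasure_associatedMeasure τ).unique ⟨hm.1, hm.2.1, fun f => ?_⟩
  rw [integral_smul_add_smul, ← (isAssociatedMeasure_associatedMeasure τ₁).2.2,
    ← (isAssociatedMeasure_associatedMeasure τ₂).2.2, h]
  rfl

section Inverse

variable (hν : ν.DominatesReduced)

/-- The tracial state on `C*_ν(G)` given by an invariant measure. -/
noncomputable def traceOfInvariantMeasure (μ : invariantMeasures G) :
    tracialStates ν.Completion :=
  have := μ.2.1
  have := μ.2.2.1
  ⟨traceOfMeasure hν (μ.1 : Measure (UnitSpace G)),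
    traceOfMeasure_mem_tracialStates hν _ μ.2.2.2⟩

lemma traceOfInvariantMeasure_embed (μ : invariantMeasures G) (f : Cc G) :
    (traceOfInvariantMeasure hν μ).1 (ν.embed f) =
      ∫ x, restrictUnits G f x ∂(μ.1 : Measure (UnitSpace G)) :=
  have := μ.2.1
  traceOfMeasure_embed hν _ f

lemma norm_traceOfInvariantMeasure_le (μ : invariantMeasures G) (a : ν.Completion) :
    ‖(traceOfInvariantMeasure hν μ).1 a‖ ≤ ‖a‖ :=
  have := μ.2.1
  norm_traceOfMeasure_le hν _ a

lemma associatedMeasure_traceOfInvariantMeasure (μ : invariantMeasures G) :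
    associatedMeasure (traceOfInvariantMeasure hν μ) = μ :=
  have := μ.2.1
  Subtype.ext
    (isAssociatedMeasure_iff.1 ⟨μ.2.1, μ.2.2.1, traceOfMeasure_unitFunction hν _⟩).symm

lemma traceOfInvariantMeasure_associatedMeasure (hfree : EssentiallyFree G)
    (τ : tracialStates ν.Completion) :
    traceOfInvariantMeasure hν (associatedMeasure τ) = τ := by
  refine Subtype.ext (DFunLike.coe_injective (ν.denseRange_embed.equalizer
    (map_continuous (traceOfInvariantMeasure hν (associatedMeasure τ)).1) (map_continuous τ.1)
    (funext fun f => (traceOfInvariantMeasure_embed hν _ f).trans ?_)))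
  exact ((isAssociatedMeasure_associatedMeasure τ).map_embed τ.2
    (hfree _ (associatedMeasure τ).2) f).symm

-- All `τ_μ` have norm at most one, so `μ ↦ τ_μ a` is a uniform limit of the functions
-- `μ ↦ ∫ f|_{G⁰} dμ` with `f ∈ C_c(G)` close to `a`.
lemma continuous_traceOfInvariantMeasure : Continuous (traceOfInvariantMeasure hν) := by
  refine continuous_induced_rng.2 (WeakDual.continuous_of_continuous_eval fun a =>
    continuous_of_uniform_approx_of_continuous fun u hu => ?_)
  obtain ⟨ε, hε, hεu⟩ := Metric.mem_uniformity_dist.1 hu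
  obtain ⟨f, hf⟩ := Metric.denseRange_iff.1 ν.denseRange_embed a ε hε
  refine ⟨fun μ => (traceOfInvariantMeasure hν μ).1 (ν.embed f), ?_, fun μ => hεu ?_⟩
  · simp_rw [traceOfInvariantMeasure_embed]
    exact continuous_iff_continuousAt.2 fun μ =>
      (FiniteMeasure.tendsto_iff_forall_integral_rclike_tendsto ℂ).1
        (continuous_subtype_val.tendsto μ) (.mkOfCompact (restrictUnits G f))
  · calc dist ((traceOfInvariantMeasure hν μ).1 a) ((traceOfInvariantMeasure hν μ).1 (ν.embed f))
        = ‖(traceOfInvariantMeasure hν μ).1 (a - ν.embed f)‖ := by rw [map_sub, dist_eq_norm]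
      _ ≤ ‖a - ν.embed f‖ := norm_traceOfInvariantMeasure_le hν μ _
      _ < ε := by rwa [← dist_eq_norm]

variable (hfree : EssentiallyFree G)

/-- The homeomorphism `τ ↦ μ_τ` between the tracial states and the invariant measures. -/
noncomputable def traceHomeomorph : tracialStates ν.Completion ≃ₜ invariantMeasures G where
  toFun := associatedMeasure
  invFun := traceOfInvariantMeasure hν
  left_inv := traceOfInvariantMeasure_associatedMeasure hν hfree
  right_inv := associatedMeasure_traceOfInvariantMeasure hν
  continuous_toFun := continuous_associatedMeasure
  continuous_invFun := continuous_traceOfInvariantMeasure hν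

include hν hfree

lemma associatedMeasure_eq_smul_add_smul_iff (τ₁ τ₂ τ : tracialStates ν.Completion) {a b : ℝ≥0}
    (hab : a + b = 1) :
    (associatedMeasure τ).1 = a • (associatedMeasure τ₁).1 + b • (associatedMeasure τ₂).1 ↔
      τ.1 = (a : ℝ) • τ₁.1 + (b : ℝ) • τ₂.1 := by
  refine ⟨fun h => ?_, associatedMeasure_affine τ₁ τ₂ τ a b hab⟩
  let σ : tracialStates ν.Completion := ⟨(a : ℝ) • τ₁.1 + (b : ℝ) • τ₂.1,
    convex_tracialStates _ τ₁.2 τ₂.2 a.2 b.2 (by exact_mod_cast hab)⟩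
  have hσ : associatedMeasure τ = associatedMeasure σ :=
    Subtype.ext (h.trans (associatedMeasure_affine τ₁ τ₂ σ a b hab rfl).symm)
  exact congrArg Subtype.val ((traceHomeomorph hν hfree).injective hσ)

lemma associatedMeasure_mem_openSegment_iff (τ₁ τ₂ τ : tracialStates ν.Completion) :
    (associatedMeasure τ).1 ∈ openSegment ℝ≥0 (associatedMeasure τ₁).1 (associatedMeasure τ₂).1 ↔
      τ.1 ∈ openSegment ℝ τ₁.1 τ₂.1 := by
  constructor
  · rintro ⟨a, b, ha, hb, hab, h⟩
    exact ⟨a, b, ha, hb, by exact_mod_cast hab,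
      ((associatedMeasure_eq_smul_add_smul_iff hν hfree τ₁ τ₂ τ hab).1 h.symm).symm⟩
  · rintro ⟨a, b, ha, hb, hab, h⟩
    lift a to ℝ≥0 using ha.le
    lift b to ℝ≥0 using hb.le
    exact ⟨a, b, ha, hb, by exact_mod_cast hab,
      (associatedMeasure_affine τ₁ τ₂ τ a b (by exact_mod_cast hab) h.symm).symm⟩

theorem tracesAreInvariantMeasures : TracesAreInvariantMeasures ν :=
  ⟨convex_tracialStates _, convex_invariantMeasures G, traceHomeomorph hν hfree,
    fun _ _ => isAssociatedMeasure_iff, associatedMeasure_affine,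
    coe_mem_extremePoints_iff_of_equiv (traceHomeomorph hν hfree).toEquiv
      (associatedMeasure_mem_openSegment_iff hν hfree)⟩

end Inverse

end Homeomorphism

end GroupoidStructure

theorem mainTheorem7 {G : Type u} [GroupoidStructure G] [TopologicalSpace G] [T2Space G]
    [LocallyCompactSpace G] [EtaleGroupoid G] [CompactSpace (UnitSpace G)]
    [MeasurableSpace G] [BorelSpace G] (hfree : EssentiallyFree G) :
    (∀ ν : CStarNorm G, ν.DominatesReduced → TracesAreInvariantMeasures ν) ∧
    (∃ ν : CStarNorm G, (∀ f, ν f = reducedNorm f) ∧ TracesAreInvariantMeasures ν) ∧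
    (∃ ν : CStarNorm G, (∀ f, ν f = maximalNorm f) ∧ TracesAreInvariantMeasures ν) :=
  ⟨fun _ hν => tracesAreInvariantMeasures hν hfree,
    ⟨reducedCStarNorm G, reducedCStarNorm_apply,
      tracesAreInvariantMeasures dominatesReduced_reducedCStarNorm hfree⟩,
    ⟨maximalCStarNorm G, maximalCStarNorm_apply,
      tracesAreInvariantMeasures dominatesReduced_maximalCStarNorm hfree⟩⟩
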